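/- Let $n\ge 1$ and let $B_{2n}$ be the braid group on $2n$ strands, with Artin generators $\sigma_1,\dots,\sigma_{2n-1}$. Let $<_D$ be the Dehornoy order on $B_{2n}$: $\alpha<_D\beta$ if and only if $\alpha^{-1}\beta$ is represented by a braid word which, for some $i$, contains $\sigma_i$ but neither $\sigma_i^{-1}$ nor any $\sigma_j^{\pm1}$ with $j<i$. Let $\tau_n\subset B^3$ be the standard trivial $n$-string tangle, whose strings join $2n$ marked points of $\partial B^3$ in adjacent pairs, and let $H_{2n}\le B_{2n}$ be the Hilden subgroup, that is, the subgroup of braids whose action on $\partial B^3$ with its $2n$ marked points extends to a homeomorphism of the pair $(B^3,\tau_n)$. Let $\mathcal P_{2n}=H_{2n}\backslash B_{2n}/H_{2n}$ be the set of Hilden double cosets. Let $c_n\colon B_{2n}\to\mathbb N$ be a proper complexity function, that is, a function such that $\{\beta\in B_{2n}\mid c_n(\beta)\le N\}$ is finite for every $N\in\mathbb N$. For $C\in\mathcal P_{2n}$ put \[ c_n(C)=\min\{c_n(\beta)\mid\beta\in C\},\qquad M_n(C)=\{\beta\in C\mid c_n(\beta)=c_n(C)\}. \] Then, for every $C\in\mathcal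 P_{2n}$, the set $M_n(C)$ is finite and nonempty and has a unique $<_D$-least element $r_{D,n}(C)$; and the relation $\prec_{D,n}$ on $\mathcal P_{2n}$ defined by \[ C_1\prec_{D,n}C_2\iff r_{D,n}(C_1)<_D r_{D,n}(C_2) \] is a strict total order on $\mathcal P_{2n}$. -/

import Mathlib

open scoped NNReal

noncomputable section

namespace Plat

/-! ### The braid group and the Dehornoy order -/

/-- Artin's relations on the generators `σ₁, …, σ_{m-1}`, which are indexed here from `0`. -/
def artinRels (m : ℕ) : Set (FreeGroup (Fin (m - 1))) :=
  {r | ∃ i j : Fin (m - 1), (i : ℕ) + 2 ≤ j ∧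
      r = .of i * .of j * (.of j * .of i)⁻¹} ∪
  {r | ∃ i j : Fin (m - 1), (i : ℕ) + 1 = j ∧
      r = .of i * .of j * .of i * (.of j * .of i * .of j)⁻¹}

/-- The braid group on `m` strands. -/
abbrev Braid (m : ℕ) : Type := PresentedGroup (artinRels m)

/-- The braid represented by a braid word; `(i, true)` stands for the generator with index `i`
and `(i, false)` for its inverse. -/
def wordBraid {m : ℕ} (w : List (Fin (m - 1) × Bool)) : Braid m :=
  PresentedGroup.mk (artinRels m) (FreeGroup.mk w)

/-- A braid word is `σ`-positive if, for the least index `i` occurring in it, the generator with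
index `i` occurs and its inverse does not. -/
def SigmaPositive {m : ℕ} (w : List (Fin (m - 1) × Bool)) : Prop :=
  ∃ i, (i, true) ∈ w ∧ (i, false) ∉ w ∧ ∀ x ∈ w, i ≤ x.1

/-- The Dehornoy order: `α <_D β` if `α⁻¹ β` is represented by a `σ`-positive word. -/
def DehornoyLT {m : ℕ} (α β : Braid m) : Prop :=
  ∃ w : List (Fin (m - 1) × Bool), SigmaPositive w ∧ wordBraid w = α⁻¹ * β

/-! ### Half twists of the plane

The marked points are `0, 1, …, 2n - 1` in `ℂ`. -/

/-- The angle of the half twist at distance `r` from its centre: `π` for `r ≤ 1/2`, `0` for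
`r ≥ 1`, and linear in between. -/
def twistAngle (r : ℝ) : ℝ := Real.pi * max 0 (min 1 (2 - 2 * r))

/-- Rotation of each circle about `c` by `s` times the angle that belongs to its radius. -/
def twistFun (c : ℂ) (s : ℝ) (z : ℂ) : ℂ :=
  c + Complex.exp ((s * twistAngle ‖z - c‖ : ℝ) * Complex.I) * (z - c)

theorem twistFun_neg (c : ℂ) (s : ℝ) (z : ℂ) : twistFun c (-s) (twistFun c s z) = z := by
  have h : ‖twistFun c s z - c‖ = ‖z - c‖ := by
    simp only [twistFun, add_sub_cancel_left, norm_mul, Complex.norm_exp_ofReal_mul_I, one_mul]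
  unfold twistFun at h ⊢
  rw [h, add_sub_cancel_left, ← mul_assoc, ← Complex.exp_add]
  simp

theorem continuous_twistFun (c : ℂ) (s : ℝ) : Continuous (twistFun c s) := by
  unfold twistFun twistAngle
  fun_prop

/-- The half twist exchanging the marked points `i` and `i + 1`; it is supported in the disc of
radius `1` about `i + 1/2`, which contains no other marked point. -/
def halfTwist (i : ℕ) : ℂ ≃ₜ ℂ where
  toFun := twistFun ((i : ℂ) + 1 / 2) 1
  invFun := twistFun ((i : ℂ) + 1 / 2) (-1)
  left_inv z := twistFun_neg _ 1 z
  right_inv z := by simpa using twistFun_neg ((i : ℂ) + 1 / 2) (-1) z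
  continuous_toFun := continuous_twistFun _ _
  continuous_invFun := continuous_twistFun _ _

/-- The action of braid words on the plane with its marked points. Words that represent the same
braid act by homeomorphisms that are isotopic relative to the marked points. -/
def wordAction (m : ℕ) : FreeGroup (Fin (m - 1)) →* (ℂ ≃ₜ ℂ) :=
  FreeGroup.lift fun i => halfTwist i

/-! ### The Hilden subgroup -/

/-- The closed 3-ball, as the closed upper half-space together with its point at infinity. Its
boundary sphere is `ℂ × {0}` together with the point at infinity. -/
abbrev Ball3 : Type := OnePoint (ℂ × ℝ≥0)

/-- The standard trivial `n`-string tangle in the ball: for each `j < n` a semicircle that joins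
the adjacent marked points `2j` and `2j + 1`. -/
def trivialTangle (n : ℕ) : Set Ball3 :=
  {p | ∃ j < n, ∃ (x : ℝ) (t : ℝ≥0), (x - (2 * j + 1 / 2)) ^ 2 + (t : ℝ) ^ 2 = 1 / 4 ∧
    p = (((x : ℂ), t) : ℂ × ℝ≥0)}

/-- `F` is a homeomorphism of the pair (ball, tangle) that restricts to `f` on the boundary
sphere. -/
def Extends (n : ℕ) (f : ℂ ≃ₜ ℂ) (F : Ball3 ≃ₜ Ball3) : Prop :=
  F OnePoint.infty = OnePoint.infty ∧
  (∀ z : ℂ, F ((z, 0) : ℂ × ℝ≥0) = ((f z, 0) : ℂ × ℝ≥0)) ∧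
  F '' trivialTangle n = trivialTangle n

/-- The homeomorphisms of the boundary sphere (fixing infinity) that extend to a homeomorphism of
the ball preserving the standard trivial tangle. -/
def extendable (n : ℕ) : Subgroup (ℂ ≃ₜ ℂ) where
  carrier := {f | ∃ F, Extends n f F}
  one_mem' := ⟨1, rfl, fun _ => rfl, Set.image_id _⟩
  mul_mem' := by
    rintro f g ⟨F, hF, hF', hF''⟩ ⟨G, hG, hG', hG''⟩
    refine ⟨F * G, ?_, fun z => ?_, ?_⟩
    · change F (G _) = _
      rw [hG, hF]
    · change F (G _) = _
      rw [hG', hF']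
      rfl
    · change (F ∘ G) '' _ = _
      rw [Set.image_comp, hG'', hF'']
  inv_mem' := by
    rintro f ⟨F, hF, hF', hF''⟩
    refine ⟨F.symm, ?_, fun z => ?_, ?_⟩
    · rw [Homeomorph.symm_apply_eq, hF]
    · rw [Homeomorph.symm_apply_eq, hF']
      change _ = (((f (f.symm z), 0) : ℂ × ℝ≥0) : Ball3)
      rw [Homeomorph.apply_symm_apply]
    · conv_lhs => rw [← hF'']
      rw [← Set.image_comp]
      simp

/-- The Hilden subgroup `H_{2n}` of the braid group on `2n` strands: the braids whose action on
the boundary sphere with its `2n` marked points extends to a homeomorphism of the pair (ball,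
standard trivial tangle). Whether it extends depends only on the isotopy class relative to the
marked points, so it does not matter which word represents the braid. -/
def hilden (n : ℕ) : Subgroup (Braid (2 * n)) :=
  ((extendable n).comap (wordAction (2 * n))).map (PresentedGroup.mk (artinRels (2 * n)))

/-- The set `P_{2n} = H_{2n} \ B_{2n} / H_{2n}` of Hilden double cosets. -/
abbrev PlatClass (n : ℕ) : Type :=
  DoubleCoset.Quotient (hilden n : Set (Braid (2 * n))) (hilden n : Set (Braid (2 * n)))

/-- A Hilden double coset as a set of braids. -/
def PlatClass.braids {n : ℕ} (C : PlatClass n) : Set (Braid (2 * n)) :=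
  {β | DoubleCoset.mk (hilden n) (hilden n) β = C}

/-! ### Complexity and canonical representatives -/

/-- A proper complexity function: all sublevel sets are finite. -/
def IsProperComplexity {n : ℕ} (c : Braid (2 * n) → ℕ) : Prop :=
  ∀ N : ℕ, {β | c β ≤ N}.Finite

/-- The least complexity of a braid in the double coset `C` (the set is never empty). -/
def classComplexity {n : ℕ} (c : Braid (2 * n) → ℕ) (C : PlatClass n) : ℕ :=
  sInf (c '' C.braids)

/-- The set `M_n(C)` of braids of least complexity in `C`. -/
def minimalBraids {n : ℕ} (c : Braid (2 * n) → ℕ) (C : PlatClass n) : Set (Braid (2 * n)) :=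
  {β | β ∈ C.braids ∧ c β = classComplexity c C}

/-- `β` is a least element of `S` for the Dehornoy order. -/
def IsDehornoyLeast {m : ℕ} (S : Set (Braid m)) (β : Braid m) : Prop :=
  β ∈ S ∧ ∀ γ ∈ S, γ = β ∨ DehornoyLT β γ

/-- The Dehornoy canonical representative `r_{D,n}(C)`: the Dehornoy-least braid in `M_n(C)`. That
such a braid exists and is unique is part of what has to be proved. -/
def canonicalRep {n : ℕ} (c : Braid (2 * n) → ℕ) (C : PlatClass n) : Braid (2 * n) :=
  Classical.epsilon (IsDehornoyLeast (minimalBraids c C))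

/-- The relation `C₁ ≺_{D,n} C₂`. -/
def PlatLT {n : ℕ} (c : Braid (2 * n) → ℕ) (C₁ C₂ : PlatClass n) : Prop :=
  DehornoyLT (canonicalRep c C₁) (canonicalRep c C₂)

end Plat

end

/-! The substance is that the Dehornoy order is a strict total order on the braid group. Granted
this, properness makes every set of minimal braids finite, and a finite nonempty set has a unique
least element. A representative lies in its class and so determines it (`canonicalRep_injective`);
the relation on classes is therefore the pullback of a strict total order along an injection.

Transitivity is concatenation of words. Irreflexivity and comparability come from Artin's action on
the free group, under which a braid sends each generator x_j to a conjugate A x_k A⁻¹.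

Irreflexivity (`wordBraid_ne_one_of_sigmaPositive`): a word that contains σ_i, no σ_i⁻¹ and
otherwise only larger indices sends x_i to an element different from x_i whose reduced word begins
with x_i.

Comparability (`eq_one_or_sigmaPositive`): let β use only generators of index at least i, and let
β(x_i) = A x_k A⁻¹. Then β or β⁻¹ is weakly positive at i according to whether A begins with x_i
(`weaklyPositive_of_head_eq`, `weaklyPositive_inv_of_head_ne`). The proof shortens A. The product
x_i ⋯ x_{m-1} is fixed, so the image of x_{i+1} ⋯ x_{m-1} is A x_k⁻¹ A⁻¹ x_i ⋯ x_{m-1}. After right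
multiplication by a braid in σ_{i+1}, σ_{i+2}, … that minimises the total length of the images of
x_{i+1}, …, x_{m-1}, the conjugated generators of these images survive reduction as marked letters,
and every long enough subword contains one (`exists_neutral_mark`). A mark next to A supplies a
braid with a single σ_i or σ_i⁻¹, of known sign, that replaces A by a shorter word. The descent ends
when x_i is fixed; then faithfulness of Artin's action (`artin_injective`) shows that σ_i is not
needed at all (`neutral_succ_of_artin_eq`).

Faithfulness is proved by combing: a braid splits into a move of the last strand to its place, a
loop of that strand around the others, and a braid on one strand fewer. The image of the last
generator detects the first two factors. -/

namespace Plat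

/-! ### Generators and the universal property of the braid group -/

/-- The Artin generator with index `i`, and `1` if there is no such generator. -/
def sg (m i : ℕ) : Braid m :=
  if h : i < m - 1 then PresentedGroup.of ⟨i, h⟩ else 1

theorem sg_of_lt {m i : ℕ} (h : i < m - 1) : sg m i = PresentedGroup.of ⟨i, h⟩ := dif_pos h

theorem sg_of_le {m i : ℕ} (h : m - 1 ≤ i) : sg m i = 1 := dif_neg (by omega)

theorem sg_comm {m i j : ℕ} (h : i + 2 ≤ j) : sg m i * sg m j = sg m j * sg m i := by
  by_cases hj : j < m - 1
  · have hi : i < m - 1 := by omega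
    rw [sg_of_lt hi, sg_of_lt hj]
    exact PresentedGroup.mk_eq_mk_of_mul_inv_mem (Or.inl ⟨⟨i, hi⟩, ⟨j, hj⟩, h, rfl⟩)
  · rw [sg_of_le (not_lt.1 hj), one_mul, mul_one]

theorem sg_braid {m i : ℕ} (h : i + 1 < m - 1) :
    sg m i * sg m (i + 1) * sg m i = sg m (i + 1) * sg m i * sg m (i + 1) := by
  have hi : i < m - 1 := by omega
  rw [sg_of_lt hi, sg_of_lt h]
  exact PresentedGroup.mk_eq_mk_of_mul_inv_mem (Or.inr ⟨⟨i, hi⟩, ⟨i + 1, h⟩, rfl, rfl⟩)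

section Lift

variable {G : Type*} [Group G]

/-- The homomorphism out of a braid group with prescribed values on the generators. -/
def braidLift (m : ℕ) (f : ℕ → G)
    (hcomm : ∀ i j, i + 2 ≤ j → j < m - 1 → f i * f j = f j * f i)
    (hbraid : ∀ i, i + 1 < m - 1 → f i * f (i + 1) * f i = f (i + 1) * f i * f (i + 1)) :
    Braid m →* G :=
  PresentedGroup.toGroup (f := fun i : Fin (m - 1) => f i) (by
    rintro r (⟨i, j, h, rfl⟩ | ⟨i, j, h, rfl⟩)
    · simp only [map_mul, map_inv, FreeGroup.lift_apply_of]
      rw [mul_inv_eq_one]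
      exact hcomm i j h j.2
    · simp only [map_mul, map_inv, FreeGroup.lift_apply_of]
      rw [mul_inv_eq_one, ← h]
      exact hbraid i (h ▸ j.2))

theorem braidLift_sg {m : ℕ} {f : ℕ → G} (hcomm hbraid) {i : ℕ} (hi : i < m - 1) :
    braidLift m f hcomm hbraid (sg m i) = f i := by
  rw [sg_of_lt hi]
  exact PresentedGroup.toGroup.of _

theorem braid_hom_ext {m : ℕ} {f g : Braid m →* G}
    (h : ∀ i < m - 1, f (sg m i) = g (sg m i)) : f = g :=
  PresentedGroup.ext fun i => by simpa [sg_of_lt i.2] using h i i.2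

end Lift

/-- Induction principle: a braid is a product of generators and their inverses. -/
theorem braid_induction {m : ℕ} {C : Braid m → Prop} (one : C 1)
    (mul : ∀ i < m - 1, ∀ β, C β → C (sg m i * β))
    (inv_mul : ∀ i < m - 1, ∀ β, C β → C ((sg m i)⁻¹ * β)) (β : Braid m) : C β := by
  obtain ⟨⟨L⟩, rfl⟩ := PresentedGroup.mk_surjective _ β
  change C (PresentedGroup.mk _ (FreeGroup.mk L))
  induction L with
  | nil => exact one
  | cons a L ih =>
    obtain ⟨i, b⟩ := a
    rw [← List.singleton_append, ← FreeGroup.mul_mk, map_mul]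
    cases b with
    | true =>
      have := mul i i.2 _ ih
      rwa [sg_of_lt i.2] at this
    | false =>
      have := inv_mul i i.2 _ ih
      rwa [sg_of_lt i.2] at this

/-! ### Artin's action on the free group -/

/-- The free generators of the group on which all braid groups act. -/
abbrev x (j : ℕ) : FreeGroup ℕ := FreeGroup.of j

/-- Artin's automorphism for the generator with index `i`, as an endomorphism. -/
def artinHom (i : ℕ) : FreeGroup ℕ →* FreeGroup ℕ :=
  FreeGroup.lift fun j =>
    if j = i then x i * x (i + 1) * (x i)⁻¹ else if j = i + 1 then x i else x j

/-- The inverse of Artin's automorphism. -/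
def artinInvHom (i : ℕ) : FreeGroup ℕ →* FreeGroup ℕ :=
  FreeGroup.lift fun j => if j = i then x (i + 1) else
    if j = i + 1 then (x (i + 1))⁻¹ * x i * x (i + 1) else x j

/-- Artin's automorphism for the generator with index `i`. -/
def artinAut (i : ℕ) : MulAut (FreeGroup ℕ) :=
  MonoidHom.toMulEquiv (artinHom i) (artinInvHom i)
    (by
      ext j
      rcases eq_or_ne j i with rfl | h
      · simp [artinHom, artinInvHom, mul_assoc]
      · rcases eq_or_ne j (i + 1) with rfl | h' <;> simp_all [artinHom, artinInvHom])
    (by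
      ext j
      rcases eq_or_ne j i with rfl | h
      · simp [artinHom, artinInvHom]
      · rcases eq_or_ne j (i + 1) with rfl | h' <;>
          simp_all [artinHom, artinInvHom, mul_assoc])

theorem artinAut_self (i : ℕ) : artinAut i (x i) = x i * x (i + 1) * (x i)⁻¹ := by
  simp [artinAut, artinHom]

theorem artinAut_succ (i : ℕ) : artinAut i (x (i + 1)) = x i := by
  simp [artinAut, artinHom]

theorem artinAut_of_ne {i j : ℕ} (h : j ≠ i) (h' : j ≠ i + 1) : artinAut i (x j) = x j := by
  simp [artinAut, artinHom, h, h']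

theorem mulAut_ext {f g : MulAut (FreeGroup ℕ)} (h : ∀ j, f (x j) = g (x j)) : f = g :=
  MulEquiv.toMonoidHom_injective (FreeGroup.ext_hom _ _ h)

theorem artinAut_comm {i j : ℕ} (h : i + 2 ≤ j) :
    artinAut i * artinAut j = artinAut j * artinAut i := by
  refine mulAut_ext fun k => ?_
  simp only [MulAut.mul_apply]
  by_cases h1 : k = i
  · subst h1
    simp [artinAut_self, artinAut_of_ne (show k ≠ j by omega) (show k ≠ j + 1 by omega),
      artinAut_of_ne (show k + 1 ≠ j by omega) (show k + 1 ≠ j + 1 by omega)]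
  by_cases h2 : k = i + 1
  · subst h2
    simp [artinAut_succ, artinAut_of_ne (show i ≠ j by omega) (show i ≠ j + 1 by omega),
      artinAut_of_ne (show i + 1 ≠ j by omega) (show i + 1 ≠ j + 1 by omega)]
  by_cases h3 : k = j
  · subst h3
    simp [artinAut_self, artinAut_of_ne h1 h2,
      artinAut_of_ne (show k + 1 ≠ i by omega) (show k + 1 ≠ i + 1 by omega)]
  by_cases h4 : k = j + 1
  · subst h4
    simp [artinAut_succ, artinAut_of_ne h1 h2,
      artinAut_of_ne (show j ≠ i by omega) (show j ≠ i + 1 by omega)]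
  · simp [artinAut_of_ne h1 h2, artinAut_of_ne h3 h4]

theorem artinAut_braid (i : ℕ) :
    artinAut i * artinAut (i + 1) * artinAut i =
      artinAut (i + 1) * artinAut i * artinAut (i + 1) := by
  have e1 : artinAut (i + 1) (x i) = x i := artinAut_of_ne (by omega) (by omega)
  have e2 : artinAut i (x (i + 1 + 1)) = x (i + 1 + 1) := artinAut_of_ne (by omega) (by omega)
  refine mulAut_ext fun k => ?_
  simp only [MulAut.mul_apply]
  by_cases h1 : k = i
  · subst h1
    simp [artinAut_self, artinAut_succ, e1, e2, mul_assoc]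
  by_cases h2 : k = i + 1
  · subst h2
    simp [artinAut_self, artinAut_succ, e1, e2]
  by_cases h3 : k = i + 1 + 1
  · subst h3
    simp [artinAut_succ, e1, e2]
  · simp [artinAut_of_ne h1 h2, artinAut_of_ne h2 h3]

/-- Artin's representation of the braid group on `m` strands. -/
def artin (m : ℕ) : Braid m →* MulAut (FreeGroup ℕ) :=
  braidLift m artinAut (fun _ _ h _ => artinAut_comm h) fun i _ => artinAut_braid i

theorem artin_sg {m i : ℕ} (hi : i < m - 1) : artin m (sg m i) = artinAut i :=
  braidLift_sg _ _ hi

/-! ### Faithfulness of Artin's representation -/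

/-- The inclusion of the braid group on `N` strands into the one on `N + 1` strands. -/
def incl (N : ℕ) : Braid N →* Braid (N + 1) :=
  braidLift N (sg (N + 1)) (fun _ _ h _ => sg_comm h) fun _ h => sg_braid (by omega)

theorem incl_sg {N j : ℕ} (hj : j < N - 1) : incl N (sg N j) = sg (N + 1) j :=
  braidLift_sg _ _ hj

theorem artin_incl {N : ℕ} (b : Braid N) : artin (N + 1) (incl N b) = artin N b := by
  suffices h : (artin (N + 1)).comp (incl N) = artin N from DFunLike.congr_fun h b
  refine braid_hom_ext fun i hi => ?_
  rw [MonoidHom.comp_apply, incl_sg hi, artin_sg hi, artin_sg (by omega)]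

/-- The braid `σ_{N-t} ⋯ σ_{N-1}` (indices from `0`). -/
def lastStrandAux (N : ℕ) : ℕ → Braid (N + 1)
  | 0 => 1
  | t + 1 => sg (N + 1) (N - (t + 1)) * lastStrandAux N t

/-- The braid `σ_i ⋯ σ_{N-1}` (indices from `0`), which moves the last strand to place `i`. -/
def lastStrand (N i : ℕ) : Braid (N + 1) := lastStrandAux N (N - i)

theorem lastStrand_self (N : ℕ) : lastStrand N N = 1 := by
  rw [lastStrand, Nat.sub_self, lastStrandAux]

theorem lastStrand_of_lt {N i : ℕ} (h : i < N) :
    lastStrand N i = sg (N + 1) i * lastStrand N (i + 1) := by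
  obtain ⟨t, ht⟩ : ∃ t, N - i = t + 1 := ⟨N - i - 1, by omega⟩
  rw [lastStrand, lastStrand, ht, show N - (i + 1) = t by omega, lastStrandAux,
    show N - (t + 1) = i by omega]

theorem sg_mul_lastStrand_of_lt {N i j : ℕ} (hi : i ≤ N) (h : j + 1 < i) :
    sg (N + 1) j * lastStrand N i = lastStrand N i * sg (N + 1) j := by
  induction hi using Nat.decreasingInduction with
  | self => rw [lastStrand_self, one_mul, mul_one]
  | of_succ i hi ih =>
    rw [lastStrand_of_lt hi, ← mul_assoc, sg_comm (by omega : j + 2 ≤ i), mul_assoc,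
      ih (by omega), mul_assoc]

theorem sg_succ_mul_lastStrand {N i j : ℕ} (h : i ≤ j) (hj : j + 1 < N) :
    sg (N + 1) (j + 1) * lastStrand N i = lastStrand N i * sg (N + 1) j := by
  induction h using Nat.decreasingInduction with
  | self =>
    rw [lastStrand_of_lt (by omega : j < N), lastStrand_of_lt hj]
    simp only [← mul_assoc]
    rw [← sg_braid (by omega : j + 1 < N + 1 - 1)]
    simp only [mul_assoc]
    rw [sg_mul_lastStrand_of_lt (by omega) (by omega)]
  | of_succ i hi ih =>
    rw [lastStrand_of_lt (by omega : i < N), ← mul_assoc,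
      ← sg_comm (by omega : i + 2 ≤ j + 1), mul_assoc, ih, mul_assoc]

/-- The pure braid in which the last strand goes once around strand `i`. -/
def loopBraid (N i : ℕ) : Braid (N + 1) :=
  (lastStrand N (i + 1))⁻¹ * sg (N + 1) i * lastStrand N i

theorem sg_mul_lastStrand_self {N j : ℕ} :
    sg (N + 1) j * lastStrand N j = lastStrand N (j + 1) * loopBraid N j := by
  simp [loopBraid, mul_assoc]

theorem sg_mul_loopBraid_of_lt {N i j : ℕ} (hi : i < N) (h : j + 1 < i) :
    sg (N + 1) j * loopBraid N i = loopBraid N i * sg (N + 1) j := by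
  have h1 := sg_mul_lastStrand_of_lt (N := N) (i := i) (j := j) (by omega) h
  have h2 := sg_mul_lastStrand_of_lt (N := N) (i := i + 1) (j := j) (by omega) (by omega)
  have h3 := sg_comm (m := N + 1) (i := j) (j := i) (by omega)
  have h2' : sg (N + 1) j * (lastStrand N (i + 1))⁻¹ = (lastStrand N (i + 1))⁻¹ * sg (N + 1) j :=
    (show Commute _ _ from h2).inv_right
  rw [loopBraid, mul_assoc _ (lastStrand N i), ← h1]
  simp only [← mul_assoc]
  rw [h2', mul_assoc _ (sg (N + 1) j), h3]
  simp only [mul_assoc]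

theorem sg_mul_loopBraid_of_gt {N i j : ℕ} (hj : j + 1 < N) (h : i < j) :
    sg (N + 1) j * loopBraid N i = loopBraid N i * sg (N + 1) j := by
  have h1 := sg_succ_mul_lastStrand (N := N) (i := i) (j := j) (by omega) hj
  have h2 := sg_succ_mul_lastStrand (N := N) (i := i + 1) (j := j) (by omega) hj
  have h3 := sg_comm (m := N + 1) (i := i) (j := j + 1) (by omega)
  have h2' : sg (N + 1) j * (lastStrand N (i + 1))⁻¹ =
      (lastStrand N (i + 1))⁻¹ * sg (N + 1) (j + 1) := by
    rw [eq_inv_mul_iff_mul_eq, ← mul_assoc, ← h2, mul_assoc, mul_inv_cancel, mul_one]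
  rw [loopBraid, mul_assoc _ (lastStrand N i), ← h1]
  simp only [← mul_assoc]
  rw [h2', mul_assoc _ (sg (N + 1) (j + 1)), ← h3]
  simp only [mul_assoc]

theorem sg_mul_loopBraid_succ {N j : ℕ} (hj : j + 1 < N) :
    sg (N + 1) j * loopBraid N (j + 1) = loopBraid N j * sg (N + 1) j := by
  have h1 := sg_mul_lastStrand_of_lt (N := N) (i := j + 1 + 1) (j := j) (by omega) (by omega)
  have h2 := sg_succ_mul_lastStrand (N := N) (i := j) (j := j) le_rfl hj
  have h1' : sg (N + 1) j * (lastStrand N (j + 1 + 1))⁻¹ =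
      (lastStrand N (j + 1 + 1))⁻¹ * sg (N + 1) j :=
    (show Commute _ _ from h1).inv_right
  have hb := sg_braid (m := N + 1) (i := j) (by omega)
  rw [loopBraid, loopBraid, mul_assoc _ (lastStrand N j), ← h2]
  simp only [← mul_assoc]
  rw [h1', lastStrand_of_lt (by omega : j < N), lastStrand_of_lt hj]
  simp only [mul_inv_rev, mul_assoc, mul_right_inj] at hb ⊢
  rw [eq_inv_mul_iff_mul_eq]
  simp only [← mul_assoc] at hb ⊢
  rw [hb]

theorem sg_mul_loopBraid_mul_loopBraid {N j : ℕ} (hj : j + 1 < N) :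
    sg (N + 1) j * (loopBraid N (j + 1) * loopBraid N j) =
      loopBraid N (j + 1) * loopBraid N j * sg (N + 1) j := by
  have h1 := sg_mul_lastStrand_of_lt (N := N) (i := j + 1 + 1) (j := j) (by omega) (by omega)
  have h2 := sg_succ_mul_lastStrand (N := N) (i := j) (j := j) le_rfl hj
  have h1' : sg (N + 1) j * (lastStrand N (j + 1 + 1))⁻¹ =
      (lastStrand N (j + 1 + 1))⁻¹ * sg (N + 1) j :=
    (show Commute _ _ from h1).inv_right
  have hb := sg_braid (m := N + 1) (i := j) (by omega)
  have e : loopBraid N (j + 1) * loopBraid N j =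
      (lastStrand N (j + 1 + 1))⁻¹ * (sg (N + 1) (j + 1) * sg (N + 1) j * lastStrand N j) := by
    simp [loopBraid, mul_assoc]
  rw [e, ← mul_assoc, h1']
  simp only [mul_assoc]
  rw [← h2]
  simp only [← mul_assoc] at hb ⊢
  rw [mul_assoc _ _ (sg (N + 1) j), mul_assoc _ _ (sg (N + 1) j)]
  simp only [mul_assoc, mul_right_inj] at hb ⊢
  simp only [← mul_assoc] at hb ⊢
  rw [hb]

/-- The homomorphism that sends the free generators to the (inverse) loops of the last strand. -/
def pushHom (N : ℕ) : FreeGroup ℕ →* Braid (N + 1) :=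
  FreeGroup.lift fun i => if i < N then (loopBraid N i)⁻¹ else 1

theorem pushHom_x {N i : ℕ} (h : i < N) : pushHom N (x i) = (loopBraid N i)⁻¹ := by
  simp [pushHom, h]

/-- Conjugation by σ_j transforms the inverse loops of the last strand by the formulas of Artin's
automorphism; these are the three preceding commutation rules. In combing, this lets σ_j pass
through a loop factor. -/
theorem sg_mul_pushHom {N j : ℕ} (hj : j < N - 1) (f : FreeGroup ℕ) :
    sg (N + 1) j * pushHom N f = pushHom N (artinAut j f) * sg (N + 1) j := by
  suffices h : ((MulAut.conj (sg (N + 1) j)).toMonoidHom.comp (pushHom N)) =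
      (pushHom N).comp (artinAut j).toMonoidHom by
    have := DFunLike.congr_fun h f
    simp only [MonoidHom.comp_apply, MulEquiv.coe_toMonoidHom, MulAut.conj_apply] at this
    rw [← this, inv_mul_cancel_right]
  refine FreeGroup.ext_hom _ _ fun i => ?_
  simp only [MonoidHom.comp_apply, MulEquiv.coe_toMonoidHom, MulAut.conj_apply]
  rw [mul_inv_eq_iff_eq_mul]
  have key : ∀ {a b : Braid (N + 1)}, sg (N + 1) j * a = b * sg (N + 1) j →
      sg (N + 1) j * a⁻¹ = b⁻¹ * sg (N + 1) j := by
    intro a b h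
    rw [eq_inv_mul_iff_mul_eq, ← mul_assoc, ← h, mul_inv_cancel_right]
  by_cases h1 : i = j
  · subst h1
    change _ * pushHom N (x i) = pushHom N (artinAut i (x i)) * _
    rw [artinAut_self, map_mul, map_mul, map_inv, pushHom_x (by omega), pushHom_x (by omega)]
    have h2 := sg_mul_loopBraid_succ (N := N) (j := i) (by omega)
    have h3 := sg_mul_loopBraid_mul_loopBraid (N := N) (j := i) (by omega)
    have e : (loopBraid N i)⁻¹ * (loopBraid N (i + 1))⁻¹ * (loopBraid N i)⁻¹⁻¹ =
        ((loopBraid N i)⁻¹ * loopBraid N (i + 1) * loopBraid N i)⁻¹ := by simp [mul_assoc]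
    rw [e]
    refine key ?_
    rw [← mul_assoc, h2] at h3
    rw [mul_assoc, mul_assoc, ← mul_assoc (loopBraid N (i + 1)), ← h3]
    simp [mul_assoc]
  by_cases h2 : i = j + 1
  · subst h2
    change _ * pushHom N (x (j + 1)) = pushHom N (artinAut j (x (j + 1))) * _
    rw [artinAut_succ, pushHom_x (by omega), pushHom_x (by omega)]
    exact key (sg_mul_loopBraid_succ (by omega))
  · change _ * pushHom N (x i) = pushHom N (artinAut j (x i)) * _
    rw [artinAut_of_ne h1 h2]
    by_cases hi : i < N
    · rw [pushHom_x hi]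
      refine key ?_
      rcases lt_or_ge i j with h | h
      · exact sg_mul_loopBraid_of_gt (by omega) h
      · exact sg_mul_loopBraid_of_lt hi (by omega)
    · simp [pushHom, hi]

theorem sg_inv_mul_pushHom {N j : ℕ} (hj : j < N - 1) (f : FreeGroup ℕ) :
    (sg (N + 1) j)⁻¹ * pushHom N f = pushHom N ((artinAut j)⁻¹ f) * (sg (N + 1) j)⁻¹ := by
  rw [inv_mul_eq_iff_eq_mul, ← mul_assoc, sg_mul_pushHom hj, mul_assoc, mul_inv_cancel, mul_one]
  simp

/-- Combing: every braid moves the last strand to its place, then moves it around the others, and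
then leaves it alone. -/
theorem exists_combing {N : ℕ} (g : Braid (N + 1)) :
    ∃ i ≤ N, ∃ f b, g = lastStrand N i * (pushHom N f * incl N b) := by
  induction g using braid_induction with
  | one => exact ⟨N, le_rfl, 1, 1, by simp [lastStrand_self]⟩
  | mul j hj g ih =>
    obtain ⟨i, hi, f, b, rfl⟩ := ih
    -- The position of σ_j relative to σ_i ⋯ σ_{N-1} decides: for j > i it passes through with its
    -- index lowered by one, for j = i it leaves a loop around strand i, for j = i - 1 it lengthens
    -- the product, and for smaller j it commutes.
    rcases lt_trichotomy i j with h | rfl | h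
    · obtain ⟨j, rfl⟩ : ∃ k, j = k + 1 := ⟨j - 1, by omega⟩
      refine ⟨i, hi, artinAut j f, sg N j * b, ?_⟩
      rw [← mul_assoc, sg_succ_mul_lastStrand (by omega) (by omega), map_mul,
        incl_sg (by omega), ← mul_assoc (pushHom N _), ← sg_mul_pushHom (by omega)]
      simp only [mul_assoc]
    · refine ⟨i + 1, by omega, (x i)⁻¹ * f, b, ?_⟩
      rw [← mul_assoc, sg_mul_lastStrand_self, map_mul, map_inv, pushHom_x (by omega), inv_inv]
      simp only [mul_assoc]
    · rcases Nat.lt_or_ge (j + 1) i with h' | h'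
      · refine ⟨i, hi, artinAut j f, sg N j * b, ?_⟩
        rw [← mul_assoc, sg_mul_lastStrand_of_lt hi h', map_mul,
          incl_sg (by omega), ← mul_assoc (pushHom N _), ← sg_mul_pushHom (by omega)]
        simp only [mul_assoc]
      · obtain rfl : i = j + 1 := by omega
        refine ⟨j, by omega, f, b, ?_⟩
        rw [← mul_assoc, ← lastStrand_of_lt (by omega)]
  | inv_mul j hj g ih =>
    obtain ⟨i, hi, f, b, rfl⟩ := ih
    have key : ∀ {a b c : Braid (N + 1)}, a * c = c * b → a⁻¹ * c = c * b⁻¹ := by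
      intro a b c h
      rw [inv_mul_eq_iff_eq_mul, ← mul_assoc, h, mul_inv_cancel_right]
    rcases lt_trichotomy i j with h | rfl | h
    · obtain ⟨j, rfl⟩ : ∃ k, j = k + 1 := ⟨j - 1, by omega⟩
      refine ⟨i, hi, (artinAut j)⁻¹ f, (sg N j)⁻¹ * b, ?_⟩
      rw [← mul_assoc, key (sg_succ_mul_lastStrand (by omega) (by omega)), map_mul, map_inv,
        incl_sg (by omega), ← mul_assoc (pushHom N _), ← sg_inv_mul_pushHom (by omega)]
      simp only [mul_assoc]
    · refine ⟨i + 1, by omega, f, b, ?_⟩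
      rw [lastStrand_of_lt (by omega)]
      simp [mul_assoc]
    · rcases Nat.lt_or_ge (j + 1) i with h' | h'
      · refine ⟨i, hi, (artinAut j)⁻¹ f, (sg N j)⁻¹ * b, ?_⟩
        rw [← mul_assoc, key (sg_mul_lastStrand_of_lt hi h'), map_mul, map_inv,
          incl_sg (by omega), ← mul_assoc (pushHom N _), ← sg_inv_mul_pushHom (by omega)]
        simp only [mul_assoc]
      · obtain rfl : i = j + 1 := by omega
        refine ⟨j, by omega, x j * f, b, ?_⟩
        rw [inv_mul_eq_iff_eq_mul, ← mul_assoc (sg (N + 1) j), sg_mul_lastStrand_self, map_mul,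
          pushHom_x (by omega)]
        simp [mul_assoc]

/-! ### The action of the combing factors on the last generator -/

theorem artin_lastStrand_last {N i : ℕ} (hi : i ≤ N) :
    artin (N + 1) (lastStrand N i) (x N) = x i := by
  induction hi using Nat.decreasingInduction with
  | self => simp [lastStrand_self]
  | of_succ i hi ih =>
    rw [lastStrand_of_lt hi, map_mul, MulAut.mul_apply, ih, artin_sg (by omega), artinAut_succ]

theorem artin_lastStrand_of_lt {N i j : ℕ} (hi : i ≤ N) (hj : j < i) :
    artin (N + 1) (lastStrand N i) (x j) = x j := by
  induction hi using Nat.decreasingInduction with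
  | self => simp [lastStrand_self]
  | of_succ i hi ih =>
    rw [lastStrand_of_lt hi, map_mul, MulAut.mul_apply, ih (by omega), artin_sg (by omega),
      artinAut_of_ne (by omega) (by omega)]

/-- The homomorphism that kills the free generators with index at least `N`. -/
def trunc (N : ℕ) : FreeGroup ℕ →* FreeGroup ℕ :=
  FreeGroup.lift fun j => if j < N then x j else 1

theorem trunc_x_of_lt {N i : ℕ} (h : i < N) : trunc N (x i) = x i := by simp [trunc, h]

theorem trunc_x_of_le {N i : ℕ} (h : N ≤ i) : trunc N (x i) = 1 := by simp [trunc, h]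

theorem pushHom_trunc {N : ℕ} (f : FreeGroup ℕ) : pushHom N (trunc N f) = pushHom N f := by
  suffices h : (pushHom N).comp (trunc N) = pushHom N from DFunLike.congr_fun h f
  refine FreeGroup.ext_hom _ _ fun i => ?_
  rcases lt_or_ge i N with h | h
  · rw [MonoidHom.comp_apply, trunc_x_of_lt h]
  · rw [MonoidHom.comp_apply, trunc_x_of_le h]
    simp [pushHom, h]

/-- The braid `g` conjugates the last generator, by `f⁻¹` modulo the last generator, and fixes the
other ones modulo the last generator. -/
def Pushes (N : ℕ) (g : Braid (N + 1)) (f : FreeGroup ℕ) : Prop :=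
  (∃ W, artin (N + 1) g (x N) = W * x N * W⁻¹ ∧ trunc N W = (trunc N f)⁻¹) ∧
    ∀ z, trunc N (artin (N + 1) g z) = trunc N z

theorem Pushes.mul {N : ℕ} {g g' : Braid (N + 1)} {f f' : FreeGroup ℕ} (h : Pushes N g f)
    (h' : Pushes N g' f') : Pushes N (g * g') (f * f') := by
  obtain ⟨⟨W, hW, hW'⟩, hz⟩ := h
  obtain ⟨⟨V, hV, hV'⟩, hz'⟩ := h'
  refine ⟨⟨artin (N + 1) g V * W, ?_, ?_⟩, fun z => ?_⟩
  · rw [map_mul, MulAut.mul_apply, hV, map_mul, map_mul, map_inv, hW]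
    simp [mul_assoc]
  · rw [map_mul, hz, hV', hW', map_mul, mul_inv_rev]
  · rw [map_mul, MulAut.mul_apply, hz, hz']

theorem Pushes.inv {N : ℕ} {g : Braid (N + 1)} {f : FreeGroup ℕ} (h : Pushes N g f) :
    Pushes N g⁻¹ f⁻¹ := by
  obtain ⟨⟨W, hW, hW'⟩, hz⟩ := h
  have hi : ∀ z, trunc N (artin (N + 1) g⁻¹ z) = trunc N z := by
    intro z
    rw [← hz, ← MulAut.mul_apply, ← map_mul, mul_inv_cancel, map_one, MulAut.one_apply]
  refine ⟨⟨artin (N + 1) g⁻¹ W⁻¹, ?_, ?_⟩, hi⟩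
  · have : x N = artin (N + 1) g⁻¹ (W * x N * W⁻¹) := by
      rw [← hW, ← MulAut.mul_apply, ← map_mul, inv_mul_cancel, map_one, MulAut.one_apply]
    rw [map_mul, map_mul, map_inv] at this
    conv_rhs => rw [this]
    simp [mul_assoc]
  · rw [hi, map_inv, hW', map_inv]

/-- The square of Artin's automorphism conjugates x_i and x_{i+1} by x_i x_{i+1}. Once x_{i+1} is
killed this is conjugation by x_i, which has no effect on either image. The loop braids are
conjugates of such squares. -/
theorem comp_artinAut_comp_artinAut {G : Type*} [Group G] {r : FreeGroup ℕ →* G} {i : ℕ}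
    (h : r (x (i + 1)) = 1) :
    (r.comp (artinAut i).toMonoidHom).comp (artinAut i).toMonoidHom = r := by
  refine FreeGroup.ext_hom _ _ fun j => ?_
  change r (artinAut i (artinAut i (x j))) = r (x j)
  by_cases hj : j = i
  · subst hj
    simp [artinAut_self, artinAut_succ, h]
  by_cases hj' : j = i + 1
  · subst hj'
    simp [artinAut_self, artinAut_succ, h]
  · rw [artinAut_of_ne hj hj', artinAut_of_ne hj hj']

theorem pushes_loopBraid {N i : ℕ} (hi : i < N) : Pushes N (loopBraid N i) (x i)⁻¹ := by
  have e : loopBraid N i =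
      (lastStrand N (i + 1))⁻¹ * (sg (N + 1) i * sg (N + 1) i) * lastStrand N (i + 1) := by
    rw [loopBraid, lastStrand_of_lt hi]
    simp only [mul_assoc]
  have h1 : artin (N + 1) (lastStrand N (i + 1))⁻¹ (x (i + 1)) = x N := by
    rw [← artin_lastStrand_last (by omega : i + 1 ≤ N), ← MulAut.mul_apply, ← map_mul,
      inv_mul_cancel, map_one, MulAut.one_apply]
  have h2 : artin (N + 1) (lastStrand N (i + 1))⁻¹ (x i) = x i := by
    conv_lhs => rw [← artin_lastStrand_of_lt (by omega : i + 1 ≤ N) (by omega : i < i + 1)]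
    rw [← MulAut.mul_apply, ← map_mul, inv_mul_cancel, map_one, MulAut.one_apply]
  refine ⟨⟨x i, ?_, ?_⟩, fun z => ?_⟩
  · rw [e]
    simp only [map_mul, MulAut.mul_apply]
    rw [artin_lastStrand_last (by omega), artin_sg (by omega), artinAut_succ, artinAut_self,
      map_mul, map_mul, map_inv (artin (N + 1) _) (x i), h1, h2]
  · rw [map_inv, inv_inv]
  · have key := comp_artinAut_comp_artinAut (i := i)
      (r := (trunc N).comp (artin (N + 1) (lastStrand N (i + 1))⁻¹).toMonoidHom)
      (by rw [MonoidHom.comp_apply, MulEquiv.coe_toMonoidHom, h1, trunc_x_of_le le_rfl])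
    have := DFunLike.congr_fun key (artin (N + 1) (lastStrand N (i + 1)) z)
    simp only [MonoidHom.comp_apply, MulEquiv.coe_toMonoidHom] at this
    rw [e, map_mul, map_mul, map_mul, artin_sg (by omega)]
    simp only [MulAut.mul_apply]
    rw [this, ← MulAut.mul_apply, ← map_mul, inv_mul_cancel, map_one, MulAut.one_apply]

theorem pushes_one (N : ℕ) : Pushes N 1 1 := ⟨⟨1, by simp, by simp⟩, fun z => by simp⟩

theorem pushes_pushHom (N : ℕ) (f : FreeGroup ℕ) : Pushes N (pushHom N f) f := by
  have hx : ∀ i, Pushes N (pushHom N (x i)) (x i) := by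
    intro i
    rcases lt_or_ge i N with h | h
    · rw [pushHom_x h]
      simpa using (pushes_loopBraid h).inv
    · have : pushHom N (x i) = 1 := by simp [pushHom, h]
      rw [this]
      exact ⟨⟨1, by simp, by rw [trunc_x_of_le h, map_one, inv_one]⟩, fun z => by simp⟩
  induction f using FreeGroup.induction_on with
  | C1 => simpa using pushes_one N
  | of i => exact hx i
  | inv_of i _ => simpa using (hx i).inv
  | mul f g hf hg => simpa using hf.mul hg

/-- An element that commutes with the generator `x N` becomes trivial when the generators with
index at least `N` are killed. -/
theorem trunc_eq_one_of_commute {N : ℕ} {W : FreeGroup ℕ} (h : W * x N * W⁻¹ = x N) :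
    trunc N W = 1 := by
  classical
  -- Lamplighter argument: in the wreath product of ℤ with the free group, generators below N move
  -- the lamplighter and x N changes the lamp at its position. If W commutes with x N, the lamp
  -- changed after W is the one at 1, so W does not move the lamplighter.
  let t : Multiplicative ℤ := Multiplicative.ofAdd 1
  let d : RegularWreathProduct (Multiplicative ℤ) (FreeGroup ℕ) := ⟨Pi.mulSingle 1 t, 1⟩
  let φ : FreeGroup ℕ →* RegularWreathProduct (Multiplicative ℤ) (FreeGroup ℕ) :=
    FreeGroup.lift fun j => if j < N then RegularWreathProduct.inl (x j) else if j = N then d else 1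
  have hr : ∀ z, (φ z).right = trunc N z := by
    intro z
    suffices e : RegularWreathProduct.rightHom.comp φ = trunc N from DFunLike.congr_fun e z
    refine FreeGroup.ext_hom _ _ fun j => ?_
    by_cases h1 : j < N
    · simp [φ, trunc, h1]
    · by_cases h2 : j = N <;> simp [φ, trunc, h1, h2, d]
  have hN : φ (x N) = d := by simp [φ]
  have e : φ W * d = d * φ W := by
    rw [← hN, ← map_mul, ← map_mul, ← mul_inv_eq_iff_eq_mul.1 h]
  have e' := congrArg (fun r => r.left 1) e
  simp only [RegularWreathProduct.mul_left, Pi.mul_apply, d, mul_one, inv_one, hr] at e'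
  rw [mul_comm, mul_left_inj, Pi.mulSingle_eq_same] at e'
  by_contra hne
  rw [Pi.mulSingle_eq_of_ne (by simpa using hne)] at e'
  exact absurd e' (by decide : (1 : Multiplicative ℤ) ≠ Multiplicative.ofAdd 1)

/-- Artin's representation is faithful. -/
theorem artin_injective (m : ℕ) {g : Braid m} (h : artin m g = 1) : g = 1 := by
  induction m with
  | zero =>
    induction g using braid_induction with
    | one => rfl
    | mul i hi => omega
    | inv_mul i hi => omega
  | succ N ih =>
    obtain ⟨i, hi, f, b, rfl⟩ := exists_combing g
    obtain ⟨⟨W, hW, hW'⟩, -⟩ := pushes_pushHom N f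
    have hb : ∀ b : Braid N, artin N b (x N) = x N := by
      intro b
      induction b using braid_induction with
      | one => simp
      | mul j hj b ih =>
        rw [map_mul, MulAut.mul_apply, ih, artin_sg hj, artinAut_of_ne (by omega) (by omega)]
      | inv_mul j hj b ih =>
        rw [map_mul, MulAut.mul_apply, ih, map_inv, artin_sg hj]
        exact (MulEquiv.symm_apply_eq _).2 (artinAut_of_ne (by omega) (by omega)).symm
    have e := DFunLike.congr_fun h (x N)
    rw [map_mul, map_mul, MulAut.mul_apply, MulAut.mul_apply, artin_incl, hb, hW, map_mul, map_mul,
      map_inv, artin_lastStrand_last hi, MulAut.one_apply] at e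
    -- The image of x N is conjugate to x i, so the exponent sum of x N distinguishes i from N.
    have hiN : i = N := by
      have e' := congrArg
        (FreeGroup.lift fun j => if j = N then Multiplicative.ofAdd (1 : ℤ) else 1) e
      by_contra hne
      simp [hne] at e'
      exact absurd e' (by decide)
    subst hiN
    rw [lastStrand_self, map_one, MulAut.one_apply] at e
    rw [trunc_eq_one_of_commute e, eq_comm, inv_eq_one] at hW'
    rw [lastStrand_self, one_mul, ← pushHom_trunc, hW', map_one, one_mul] at h ⊢
    rw [artin_incl] at h
    rw [ih h, map_one]

/-! ### First letters and acyclicity -/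

theorem mk_cons_true (j : ℕ) (L : List (ℕ × Bool)) :
    FreeGroup.mk ((j, true) :: L) = x j * FreeGroup.mk L := rfl

theorem mk_cons_false (j : ℕ) (L : List (ℕ × Bool)) :
    FreeGroup.mk ((j, false) :: L) = (x j)⁻¹ * FreeGroup.mk L := rfl

theorem toWord_mk_of_isReduced {L : List (ℕ × Bool)} (h : FreeGroup.IsReduced L) :
    (FreeGroup.mk L).toWord = L := by
  rw [FreeGroup.toWord_mk, h.reduce_eq]

/-- How the first letters of a reduced word `L` determine those of its image under Artin's
automorphism with index `j`. -/
inductive HeadTable (j : ℕ) : List (ℕ × Bool) → List (ℕ × Bool) → Prop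
  | nil : HeadTable j [] []
  | pos (L t) : HeadTable j ((j, true) :: L) ((j, true) :: (j + 1, true) :: t)
  | neg (L t) : HeadTable j ((j, false) :: L) ((j, true) :: (j + 1, false) :: t)
  | succ_pos (L t) (h : ∀ e s, t ≠ (j + 1, e) :: s) :
      HeadTable j ((j + 1, true) :: L) ((j, true) :: t)
  | succ_neg (L t) : HeadTable j ((j + 1, false) :: L) ((j, false) :: t)
  | succ_neg' (L t e) : HeadTable j ((j + 1, false) :: L) ((j + 1, e) :: t)
  | other (L t k e) (h : k ≠ j) (h' : k ≠ j + 1) : HeadTable j ((k, e) :: L) ((k, e) :: t)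

-- Induction on the word: prepending a letter prepends its image, and the table for the tail says
-- exactly how much cancels. The side condition in `succ_pos` is needed when x_j or its inverse is
-- prepended: the final x_j⁻¹ of the new image then cancels the leading x_j, leaving x_{j+1} or its
-- inverse in front of `t`.
open FreeGroup (IsReduced mk one_eq_mk) in
theorem exists_headTable (j : ℕ) (L : List (ℕ × Bool)) (hL : IsReduced L) :
    ∃ W, IsReduced W ∧ mk W = artinAut j (mk L) ∧ HeadTable j L W := by
  induction L with
  | nil => exact ⟨[], .nil, (map_one _).symm, .nil⟩
  | cons a L ih =>
    obtain ⟨W, hW, hmk, hT⟩ := ih (List.IsChain.tail hL)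
    obtain ⟨k, e⟩ := a
    by_cases h1 : k = j
    · subst h1
      cases e with
      | true =>
        rw [mk_cons_true, map_mul, ← hmk, artinAut_self]
        cases hT with
        | nil =>
          exact ⟨[(k, true), (k + 1, true), (k, false)], by simp,
            by simp [mk_cons_true, mk_cons_false, mul_assoc, ← one_eq_mk], .pos _ _⟩
        | pos L t =>
          exact ⟨(k, true) :: (k + 1, true) :: (k + 1, true) :: t, by simp_all,
            by simp [mk_cons_true, mul_assoc], .pos _ _⟩
        | neg L t => simp at hL
        | succ_pos L t h =>
          refine ⟨(k, true) :: (k + 1, true) :: t, ?_, by simp [mk_cons_true, mul_assoc], .pos _ _⟩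
          rcases t with _ | ⟨⟨p, q⟩, t⟩
          · simp
          · have : p ≠ k + 1 := fun hp => h q t (by rw [hp])
            simp_all [eq_comm]
        | succ_neg L t =>
          exact ⟨(k, true) :: (k + 1, true) :: (k, false) :: (k, false) :: t, by simp_all,
            by simp [mk_cons_true, mk_cons_false, mul_assoc], .pos _ _⟩
        | succ_neg' L t e =>
          exact ⟨(k, true) :: (k + 1, true) :: (k, false) :: (k + 1, e) :: t, by simp_all,
            by simp [mk_cons_true, mk_cons_false, mul_assoc], .pos _ _⟩
        | other L t p e h h' =>
          exact ⟨(k, true) :: (k + 1, true) :: (k, false) :: (p, e) :: t, by simp_all [eq_comm],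
            by simp [mk_cons_true, mk_cons_false, mul_assoc], .pos _ _⟩
      | false =>
        rw [mk_cons_false, map_mul, ← hmk, map_inv, artinAut_self]
        cases hT with
        | nil =>
          exact ⟨[(k, true), (k + 1, false), (k, false)], by simp,
            by simp [mk_cons_true, mk_cons_false, mul_assoc, ← one_eq_mk], .neg _ _⟩
        | neg L t =>
          exact ⟨(k, true) :: (k + 1, false) :: (k + 1, false) :: t, by simp_all,
            by simp [mk_cons_true, mk_cons_false, mul_assoc], .neg _ _⟩
        | pos L t => simp at hL
        | succ_pos L t h =>
          refine ⟨(k, true) :: (k + 1, false) :: t, ?_,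
            by simp [mk_cons_true, mk_cons_false, mul_assoc], .neg _ _⟩
          rcases t with _ | ⟨⟨p, q⟩, t⟩
          · simp
          · have : p ≠ k + 1 := fun hp => h q t (by rw [hp])
            simp_all [eq_comm]
        | succ_neg L t =>
          exact ⟨(k, true) :: (k + 1, false) :: (k, false) :: (k, false) :: t, by simp_all,
            by simp [mk_cons_true, mk_cons_false, mul_assoc], .neg _ _⟩
        | succ_neg' L t e =>
          exact ⟨(k, true) :: (k + 1, false) :: (k, false) :: (k + 1, e) :: t, by simp_all,
            by simp [mk_cons_true, mk_cons_false, mul_assoc], .neg _ _⟩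
        | other L t p e h h' =>
          exact ⟨(k, true) :: (k + 1, false) :: (k, false) :: (p, e) :: t, by simp_all [eq_comm],
            by simp [mk_cons_true, mk_cons_false, mul_assoc], .neg _ _⟩
    by_cases h2 : k = j + 1
    · subst h2
      cases e with
      | true =>
        rw [mk_cons_true, map_mul, ← hmk, artinAut_succ]
        refine ⟨(j, true) :: W, ?_, rfl, .succ_pos _ _ ?_⟩
        · cases hT with
          | other L t p e h h' => simp_all [eq_comm]
          | nil => simp
          | _ => simp_all
        · rintro e s rfl
          cases hT <;> simp_all
      | false =>
        rw [mk_cons_false, map_mul, ← hmk, map_inv, artinAut_succ]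
        cases hT with
        | pos L t =>
          exact ⟨(j + 1, true) :: t, by simp_all, by simp [mk_cons_true], .succ_neg' _ _ _⟩
        | neg L t =>
          exact ⟨(j + 1, false) :: t, by simp_all, by simp [mk_cons_true], .succ_neg' _ _ _⟩
        | succ_pos L t => simp at hL
        | nil => exact ⟨[(j, false)], by simp, rfl, .succ_neg _ _⟩
        | succ_neg L t =>
          exact ⟨(j, false) :: (j, false) :: t, by simp_all, rfl, .succ_neg _ _⟩
        | succ_neg' L t e =>
          exact ⟨(j, false) :: (j + 1, e) :: t, by simp_all, rfl, .succ_neg _ _⟩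
        | other L t p e h h' =>
          exact ⟨(j, false) :: (p, e) :: t, by simp_all [eq_comm], rfl, .succ_neg _ _⟩
    · refine ⟨(k, e) :: W, ?_, ?_, .other _ _ _ _ h1 h2⟩
      · have hr : ∀ p q t, W = (p, q) :: t → k = p → e = q := by
          rintro p q t rfl rfl
          cases hT with
          | other L t k e _ _ => exact (FreeGroup.isReduced_cons_cons.1 hL).1 rfl
          | _ => contradiction
        rcases W with _ | ⟨⟨p, q⟩, t⟩
        · simp
        · exact FreeGroup.isReduced_cons_cons.2 ⟨hr p q t rfl, hW⟩
      · cases e with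
        | true => rw [mk_cons_true, mk_cons_true, map_mul, artinAut_of_ne h1 h2, hmk]
        | false => rw [mk_cons_false, mk_cons_false, map_mul, map_inv, artinAut_of_ne h1 h2, hmk]

theorem headTable_toWord (j : ℕ) (u : FreeGroup ℕ) :
    HeadTable j u.toWord (artinAut j u).toWord := by
  obtain ⟨W, hW, hmk, hT⟩ := exists_headTable j u.toWord FreeGroup.isReduced_toWord
  rw [FreeGroup.mk_toWord] at hmk
  rwa [← hmk, toWord_mk_of_isReduced hW]

theorem head_artinAut_self {j : ℕ} {u : FreeGroup ℕ} (h : u.toWord.head? = some (j, true)) :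
    (artinAut j u).toWord.head? = some (j, true) := by
  have hT := headTable_toWord j u
  revert h hT
  generalize u.toWord = L
  generalize (artinAut j u).toWord = W
  intro h hT
  cases hT <;> simp_all

theorem head_artinAut_iff {j k : ℕ} {e : Bool} (h1 : k ≠ j) (h2 : k ≠ j + 1) (u : FreeGroup ℕ) :
    (artinAut j u).toWord.head? = some (k, e) ↔ u.toWord.head? = some (k, e) := by
  have hT := headTable_toWord j u
  revert hT
  generalize u.toWord = L
  generalize (artinAut j u).toWord = W
  intro hT
  cases hT <;> simp_all [eq_comm]

/-! ### Images of generators under words without an inverse of the least generator -/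

theorem wordBraid_nil {m : ℕ} : wordBraid (m := m) [] = 1 := rfl

theorem wordBraid_cons_true {m : ℕ} (i : Fin (m - 1)) (w : List (Fin (m - 1) × Bool)) :
    wordBraid ((i, true) :: w) = sg m i * wordBraid w := by
  rw [sg_of_lt i.2]
  rfl

theorem wordBraid_cons_false {m : ℕ} (i : Fin (m - 1)) (w : List (Fin (m - 1) × Bool)) :
    wordBraid ((i, false) :: w) = (sg m i)⁻¹ * wordBraid w := by
  rw [sg_of_lt i.2]
  rfl

theorem wordBraid_append {m : ℕ} (v w : List (Fin (m - 1) × Bool)) :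
    wordBraid (v ++ w) = wordBraid v * wordBraid w := by
  rw [wordBraid, ← FreeGroup.mul_mk, map_mul]
  rfl

/-- The letters act from the right end of the word, and σ_i and all σ_k^{±1} with k > i preserve an
initial x_i. An occurrence of σ_i cannot yield x_i, since its argument would be x_{i+1}, which has
the wrong first letter; the letters σ_k^{±1} with k > i fix x_i, so they cannot restore it. -/
theorem head_artin_wordBraid {m : ℕ} (i : Fin (m - 1)) (w : List (Fin (m - 1) × Bool))
    (h1 : (i, false) ∉ w) (h2 : ∀ a ∈ w, i ≤ a.1) :
    (artin m (wordBraid w) (x i)).toWord.head? = some ((i : ℕ), true) ∧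
      ((i, true) ∈ w → artin m (wordBraid w) (x i) ≠ x i) := by
  induction w with
  | nil => simp [wordBraid_nil]
  | cons a w ih =>
    obtain ⟨ih1, ih2⟩ := ih (by simp_all) (by simp_all)
    obtain ⟨k, e⟩ := a
    have hik : i ≤ k := h2 _ (List.mem_cons_self)
    rcases eq_or_lt_of_le hik with rfl | hlt
    · cases e with
      | false => simp at h1
      | true =>
        rw [wordBraid_cons_true, map_mul, MulAut.mul_apply, artin_sg i.2]
        refine ⟨head_artinAut_self ih1, fun _ he => ?_⟩
        replace he := (artinAut i).injective (he.trans (artinAut_succ i).symm)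
        rw [he, FreeGroup.toWord_of] at ih1
        simp at ih1
    · have hlt' : (i : ℕ) < k := hlt
      have hx := artinAut_of_ne (show (i : ℕ) ≠ k by omega) (by omega)
      have hmem : (i, true) ∈ (k, e) :: w → (i, true) ∈ w := by
        intro h
        rcases List.mem_cons.1 h with h | h
        · rw [Prod.mk.injEq] at h
          exact absurd h.1 hlt.ne
        · exact h
      cases e with
      | true =>
        rw [wordBraid_cons_true, map_mul, MulAut.mul_apply, artin_sg k.2]
        refine ⟨(head_artinAut_iff (by omega) (by omega) _).2 ih1, fun h he =>
          ih2 (hmem h) ((artinAut k).injective (he.trans hx.symm))⟩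
      | false =>
        rw [wordBraid_cons_false, map_mul, MulAut.mul_apply, map_inv, artin_sg k.2]
        refine ⟨(head_artinAut_iff (j := k) (by omega) (by omega) _).1 ?_,
          fun h he => ih2 (hmem h) ?_⟩
        · rw [MulAut.apply_inv_self]
          exact ih1
        · exact ((MulEquiv.symm_apply_eq _).1 he).trans hx

/-- A `σ`-positive word does not represent the trivial braid. -/
theorem wordBraid_ne_one_of_sigmaPositive {m : ℕ} {w : List (Fin (m - 1) × Bool)}
    (h : SigmaPositive w) : wordBraid w ≠ 1 := by
  obtain ⟨i, h1, h2, h3⟩ := h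
  intro he
  refine (head_artin_wordBraid i w h2 h3).2 h1 ?_
  rw [he, map_one, MulAut.one_apply]

open FreeGroup (mk IsReduced invRev)

/-! ### Reduced words -/

theorem isReduced_append_cons {L₁ L₂ : List (ℕ × Bool)} {a : ℕ × Bool} (h₁ : IsReduced L₁)
    (h₂ : IsReduced (a :: L₂)) (h : L₁.getLast? ≠ some (a.1, !a.2)) :
    IsReduced (L₁ ++ a :: L₂) := by
  refine List.IsChain.append h₁ h₂ ?_
  intro b hb c hc hbc
  simp only [List.head?_cons, Option.mem_def, Option.some.injEq] at hc
  subst hc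
  obtain ⟨b1, b2⟩ := b
  obtain ⟨c1, c2⟩ := a
  simp only [Option.mem_def] at hb hbc
  subst hbc
  by_contra hne
  refine h ?_
  rw [hb]
  cases b2 <;> cases c2 <;> simp_all

theorem isReduced_cons {L : List (ℕ × Bool)} {a : ℕ × Bool} (hL : IsReduced L)
    (h : L.head? ≠ some (a.1, !a.2)) : IsReduced (a :: L) := by
  rcases L with _ | ⟨⟨c1, c2⟩, L⟩
  · simp
  · obtain ⟨a1, a2⟩ := a
    refine FreeGroup.isReduced_cons_cons.2 ⟨fun he => ?_, hL⟩
    simp only at he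
    subst he
    by_contra hne
    refine h ?_
    cases a2 <;> cases c2 <;> simp_all

theorem head_invRev (L : List (ℕ × Bool)) :
    (invRev L).head? = L.getLast?.map fun a => (a.1, !a.2) := by
  simp [invRev, List.head?_reverse]

theorem getLast_invRev (L : List (ℕ × Bool)) :
    (invRev L).getLast? = L.head?.map fun a => (a.1, !a.2) := by
  simp [invRev, List.getLast?_reverse]

theorem isReduced_invRev {L : List (ℕ × Bool)} (h : IsReduced L) : IsReduced (invRev L) := by
  rw [FreeGroup.isReduced_iff_reduce_eq, FreeGroup.reduce_invRev, h.reduce_eq]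

theorem norm_mk_of_isReduced {L : List (ℕ × Bool)} (h : IsReduced L) :
    (mk L).norm = L.length := by
  rw [FreeGroup.norm, toWord_mk_of_isReduced h]

/-! ### Conjugates of generators -/

/-- The conjugate of the generator `x k` by `A`. -/
def arc (A : FreeGroup ℕ) (k : ℕ) : FreeGroup ℕ := A * x k * A⁻¹

/-- The reduced word `L` does not end in the generator `x k` or its inverse. -/
def Tight (L : List (ℕ × Bool)) (k : ℕ) : Prop := ∀ e, L.getLast? ≠ some (k, e)

theorem conj_arc (g A : FreeGroup ℕ) (k : ℕ) : g * arc A k * g⁻¹ = arc (g * A) k := by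
  simp [arc, mul_assoc]

theorem norm_arc_le (A : FreeGroup ℕ) (k : ℕ) : (arc A k).norm ≤ 2 * A.norm + 1 := by
  have h1 := FreeGroup.norm_mul_le (A * x k) A⁻¹
  have h2 := FreeGroup.norm_mul_le A (x k)
  rw [FreeGroup.norm_inv_eq] at h1
  rw [FreeGroup.norm_of] at h2
  rw [arc]
  omega

theorem norm_arc {A : FreeGroup ℕ} {k : ℕ} (h : Tight A.toWord k) :
    (arc A k).norm = 2 * A.norm + 1 := by
  have e : arc A k = mk (A.toWord ++ (k, true) :: invRev A.toWord) := by
    rw [← FreeGroup.mul_mk, mk_cons_true, ← FreeGroup.inv_mk, FreeGroup.mk_toWord, arc, mul_assoc]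
  rw [e, norm_mk_of_isReduced]
  · simp [FreeGroup.norm]
    omega
  · refine isReduced_append_cons FreeGroup.isReduced_toWord (isReduced_cons
      (isReduced_invRev FreeGroup.isReduced_toWord) ?_) (h _)
    rw [head_invRev]
    intro he
    obtain ⟨⟨a, b⟩, ha, hb⟩ := Option.map_eq_some_iff.1 he
    obtain ⟨rfl, -⟩ := Prod.mk.inj hb
    exact h _ ha

/-- A conjugating word can be shortened so that it does not end in the conjugated generator. -/
theorem exists_tight (D : List (ℕ × Bool)) (k : ℕ) :
    ∃ A E, D = A ++ E ∧ (∀ a ∈ E, a.1 = k) ∧ Tight A k ∧ arc (mk D) k = arc (mk A) k := by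
  induction D using List.reverseRecOn with
  | nil => exact ⟨[], [], rfl, by simp, by simp [Tight], rfl⟩
  | append_singleton D a ih =>
    obtain ⟨p, e⟩ := a
    by_cases h : p = k
    · subst h
      obtain ⟨A, E, rfl, hE, hA, he⟩ := ih
      refine ⟨A, E ++ [(p, e)], by simp, ?_, hA, ?_⟩
      · intro a ha
        rcases List.mem_append.1 ha with h | h
        · exact hE a h
        · simp_all
      · rw [← he, ← FreeGroup.mul_mk]
        cases e with
        | true =>
          rw [show mk [(p, true)] = x p from rfl]
          simp [arc, mul_assoc]
        | false =>
          rw [show mk [(p, false)] = (x p)⁻¹ from rfl]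
          simp [arc, mul_assoc]
    · exact ⟨D ++ [(p, e)], [], by simp, by simp, by simp [Tight, h], rfl⟩

theorem norm_mul_of_head {A g : FreeGroup ℕ} {k : ℕ} {e : Bool} {t : List (ℕ × Bool)}
    (h : Tight A.toWord k) (hg : g.toWord = (k, e) :: t) :
    (A * g).norm = A.norm + 1 + t.length := by
  have he : A * g = mk (A.toWord ++ (k, e) :: t) := by
    rw [← FreeGroup.mul_mk, ← hg, FreeGroup.mk_toWord, FreeGroup.mk_toWord]
  rw [he, norm_mk_of_isReduced]
  · simp [FreeGroup.norm]
    omega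
  · refine isReduced_append_cons FreeGroup.isReduced_toWord ?_ (h _)
    rw [← hg]
    exact FreeGroup.isReduced_toWord

/-- Here A' = A x_k⁻¹ t without cancellation, because A does not end in x_k^{±1}. Conjugation by A
x_k A⁻¹ turns A' into A t, which is shorter. -/
theorem norm_conj_lt_of_head {A A' : FreeGroup ℕ} {k k' : ℕ} (h : Tight A.toWord k)
    (h' : Tight A'.toWord k') (hd : (A⁻¹ * A').toWord.head? = some (k, false)) :
    (arc A k * arc A' k' * (arc A k)⁻¹).norm < (arc A' k').norm := by
  obtain ⟨t, ht⟩ : ∃ t, (A⁻¹ * A').toWord = (k, false) :: t := List.head?_eq_some_iff.1 hd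
  have hn := norm_mul_of_head h ht
  rw [mul_inv_cancel_left] at hn
  rw [conj_arc, norm_arc h', hn]
  have e : arc A k * A' = A * mk t := by
    have : A' = A * ((x k)⁻¹ * mk t) := by
      rw [← mk_cons_false, ← ht, FreeGroup.mk_toWord, mul_inv_cancel_left]
    rw [this]
    simp [arc, mul_assoc]
  have h1 := norm_arc_le (arc A k * A') k'
  have h2 := FreeGroup.norm_mul_le A (mk t)
  have h3 : (mk t).norm ≤ t.length := FreeGroup.norm_mk_le
  rw [e] at h1 ⊢
  omega

theorem norm_conj_lt_of_getLast {A A' : FreeGroup ℕ} {k k' : ℕ} (h : Tight A.toWord k)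
    (h' : Tight A'.toWord k') (hd : (A⁻¹ * A').toWord.getLast? = some (k', false)) :
    ((arc A' k')⁻¹ * arc A k * arc A' k').norm < (arc A k).norm := by
  have hd' : (A'⁻¹ * A).toWord.head? = some (k', true) := by
    rw [show A'⁻¹ * A = (A⁻¹ * A')⁻¹ by simp, FreeGroup.toWord_inv, head_invRev, hd]
    rfl
  obtain ⟨t, ht⟩ : ∃ t, (A'⁻¹ * A).toWord = (k', true) :: t := List.head?_eq_some_iff.1 hd'
  have hn := norm_mul_of_head h' ht
  rw [mul_inv_cancel_left] at hn
  have hc := conj_arc (arc A' k')⁻¹ A k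
  rw [inv_inv] at hc
  rw [hc, norm_arc h, hn]
  have e : (arc A' k')⁻¹ * A = A' * mk t := by
    have : A = A' * (x k' * mk t) := by
      rw [← mk_cons_true, ← ht, FreeGroup.mk_toWord, mul_inv_cancel_left]
    rw [this]
    simp [arc, mul_assoc]
  have h1 := norm_arc_le ((arc A' k')⁻¹ * A) k
  have h2 := FreeGroup.norm_mul_le A' (mk t)
  have h3 : (mk t).norm ≤ t.length := FreeGroup.norm_mk_le
  rw [e] at h1 ⊢
  omega

/-! ### Marked words -/

/-- The letters of a marked word. -/
def letters (M : List ((ℕ × Bool) × Bool)) : List (ℕ × Bool) := M.map Prod.fst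

/-- The unmarked letters of a marked word. -/
def unmarked (M : List ((ℕ × Bool) × Bool)) : List (ℕ × Bool) :=
  (M.filter fun a => !a.2).map Prod.fst

/-- The word `L` with no letter marked. -/
def unmark (L : List (ℕ × Bool)) : List ((ℕ × Bool) × Bool) := L.map fun a => (a, false)

theorem letters_append (M M' : List ((ℕ × Bool) × Bool)) :
    letters (M ++ M') = letters M ++ letters M' := List.map_append

theorem unmarked_append (M M' : List ((ℕ × Bool) × Bool)) :
    unmarked (M ++ M') = unmarked M ++ unmarked M' := by simp [unmarked]

theorem letters_unmark (L : List (ℕ × Bool)) : letters (unmark L) = L := by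
  simp [letters, unmark, Function.comp_def]

theorem unmarked_unmark (L : List (ℕ × Bool)) : unmarked (unmark L) = L := by
  simp [unmarked, unmark, List.filter_map, Function.comp_def]

/-- The product of the conjugates in a list. -/
def arcProd (l : List (FreeGroup ℕ × ℕ)) : FreeGroup ℕ := (l.map fun a => arc a.1 a.2).prod

/-- The marked word for the product of a list of conjugates of generators, in which the conjugated
generators are marked. -/
def markedWord (P : FreeGroup ℕ) : List (FreeGroup ℕ × ℕ) → List ((ℕ × Bool) × Bool)
  | [] => unmark P⁻¹.toWord
  | (A, k) :: l => unmark (P⁻¹ * A).toWord ++ ((k, true), true) :: markedWord A l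

/-- Without the marks the word is P⁻¹A₁ · A₁⁻¹A₂ ⋯ A_s⁻¹, which telescopes; for P = 1 the unmarked
letters multiply to 1. -/
theorem mk_unmarked_markedWord (P : FreeGroup ℕ) (l : List (FreeGroup ℕ × ℕ)) :
    mk (unmarked (markedWord P l)) = P⁻¹ := by
  induction l generalizing P with
  | nil => rw [markedWord, unmarked_unmark, FreeGroup.mk_toWord]
  | cons a l ih =>
    obtain ⟨A, k⟩ := a
    have : unmarked (((k, true), true) :: markedWord A l) = unmarked (markedWord A l) := by
      simp [unmarked]
    rw [markedWord, unmarked_append, unmarked_unmark, this, ← FreeGroup.mul_mk, ih,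
      FreeGroup.mk_toWord, mul_inv_cancel_right]

theorem mk_letters_markedWord (P : FreeGroup ℕ) (l : List (FreeGroup ℕ × ℕ)) :
    mk (letters (markedWord P l)) = P⁻¹ * arcProd l := by
  induction l generalizing P with
  | nil => rw [markedWord, letters_unmark, FreeGroup.mk_toWord]; simp [arcProd]
  | cons a l ih =>
    obtain ⟨A, k⟩ := a
    have : letters (((k, true), true) :: markedWord A l) = (k, true) :: letters (markedWord A l) :=
      rfl
    rw [markedWord, letters_append, letters_unmark, this, ← FreeGroup.mul_mk, mk_cons_true, ih,
      FreeGroup.mk_toWord]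
    simp [arcProd, arc, mul_assoc]

theorem length_unmarked_markedWord (P : FreeGroup ℕ) (l : List (FreeGroup ℕ × ℕ)) :
    (unmarked (markedWord P l)).length + l.length = (letters (markedWord P l)).length := by
  induction l generalizing P with
  | nil => simp [markedWord, letters_unmark, unmarked_unmark]
  | cons a l ih =>
    obtain ⟨A, k⟩ := a
    have h1 : letters (((k, true), true) :: markedWord A l) =
      (k, true) :: letters (markedWord A l) := rfl
    have h2 : unmarked (((k, true), true) :: markedWord A l) = unmarked (markedWord A l) := by
      simp [unmarked]
    have := ih A
    rw [markedWord, letters_append, letters_unmark, unmarked_append, unmarked_unmark, h1, h2]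
    simp only [List.length_append, List.length_cons]
    omega

/-- A mark in the marked word of a product comes from one of the factors. -/
theorem markedWord_eq_append_cons {P : FreeGroup ℕ} {l : List (FreeGroup ℕ × ℕ)}
    {M₁ M₂ : List ((ℕ × Bool) × Bool)} {a : ℕ × Bool}
    (h : markedWord P l = M₁ ++ (a, true) :: M₂) :
    ∃ l₁ A k l₂, l = l₁ ++ (A, k) :: l₂ ∧ a = (k, true) ∧
      P * mk (letters M₁) = arcProd l₁ * A ∧ l₁.length ≤ M₁.length ∧ l₂.length ≤ M₂.length := by
  induction l generalizing P M₁ with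
  | nil =>
    have : (a, true) ∈ unmark P⁻¹.toWord := by
      rw [markedWord] at h
      rw [h]
      simp
    simp [unmark] at this
  | cons b l ih =>
    obtain ⟨A, k⟩ := b
    rw [markedWord] at h
    rcases List.append_eq_append_iff.1 h with ⟨c, rfl, hc⟩ | ⟨c, hc, hc'⟩
    · rcases c with _ | ⟨d, c⟩
      · simp only [List.nil_append, List.cons.injEq, Prod.mk.injEq, and_true] at hc
        obtain ⟨rfl, rfl⟩ := hc
        refine ⟨[], A, k, l, rfl, rfl, ?_, by simp, ?_⟩
        · rw [List.append_nil, letters_unmark, FreeGroup.mk_toWord]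
          simp [arcProd]
        · have := length_unmarked_markedWord A l
          simp only [letters, List.length_map] at this
          omega
      · simp only [List.cons_append, List.cons.injEq] at hc
        obtain ⟨rfl, hc⟩ := hc
        obtain ⟨l₁, A', k', l₂, rfl, ha, hm, h1, h2⟩ := ih hc
        refine ⟨(A, k) :: l₁, A', k', l₂, rfl, ha, ?_, ?_, h2⟩
        · have e : letters (((k, true), true) :: c) = (k, true) :: letters c := rfl
          have hm' : mk (letters c) = A⁻¹ * (arcProd l₁ * A') := by rw [← hm, inv_mul_cancel_left]
          rw [letters_append, letters_unmark, e, ← FreeGroup.mul_mk, mk_cons_true, hm',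
            FreeGroup.mk_toWord]
          simp [arcProd, arc, mul_assoc]
        · simp only [List.length_append, List.length_cons]
          omega
    · rcases c with _ | ⟨d, c⟩
      · simp only [List.nil_append, List.cons.injEq, Prod.mk.injEq, and_true] at hc'
        obtain ⟨rfl, rfl⟩ := hc'
        rw [List.append_nil] at hc
        subst hc
        refine ⟨[], A, k, l, rfl, rfl, ?_, by simp, ?_⟩
        · rw [letters_unmark, FreeGroup.mk_toWord]
          simp [arcProd]
        · have := length_unmarked_markedWord A l
          simp only [letters, List.length_map] at this
          omega
      · simp only [List.cons_append, List.cons.injEq] at hc'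
        obtain ⟨rfl, -⟩ := hc'
        have : (a, true) ∈ unmark (P⁻¹ * A).toWord := by
          rw [hc]
          simp
        simp [unmark] at this

/-- Two consecutive conjugates of generators such that neither conjugates the other one to a
shorter element. -/
def Nonabsorbing (a b : FreeGroup ℕ × ℕ) : Prop :=
  (a.1⁻¹ * b.1).toWord.head? ≠ some (a.2, false) ∧
    (a.1⁻¹ * b.1).toWord.getLast? ≠ some (b.2, false)

/-- Cancellation could occur only next to a mark. Between two marks it is excluded by
`Nonabsorbing`, and after the last mark by tightness. -/
theorem isReduced_letters_markedWord_of_chain (a : FreeGroup ℕ × ℕ) (l : List (FreeGroup ℕ × ℕ))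
    (hl : ∀ b ∈ a :: l, Tight b.1.toWord b.2) (hc : (a :: l).IsChain Nonabsorbing) :
    IsReduced ((a.2, true) :: letters (markedWord a.1 l)) := by
  induction l generalizing a with
  | nil =>
    rw [markedWord, letters_unmark]
    refine isReduced_cons FreeGroup.isReduced_toWord ?_
    rw [FreeGroup.toWord_inv, head_invRev]
    intro he
    obtain ⟨⟨p, q⟩, hp, hq⟩ := Option.map_eq_some_iff.1 he
    obtain ⟨rfl, -⟩ := Prod.mk.inj hq
    exact hl a (by simp) _ hp
  | cons b l ih =>
    obtain ⟨A, k⟩ := b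
    rw [List.isChain_cons_cons] at hc
    have hr := ih (A, k) (fun b hb => hl b (List.mem_cons_of_mem _ hb)) hc.2
    rw [markedWord, letters_append, letters_unmark]
    have e : letters (((k, true), true) :: markedWord A l) =
        (k, true) :: letters (markedWord A l) := rfl
    rw [e]
    have h1 := isReduced_append_cons (L₁ := (a.1⁻¹ * A).toWord) FreeGroup.isReduced_toWord hr
      hc.1.2
    refine isReduced_cons h1 ?_
    have := hc.1.1
    rcases h : (a.1⁻¹ * A).toWord with _ | ⟨c, t⟩
    · simp
    · simp only at this
      rw [h] at this
      simpa using this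

theorem isReduced_letters_markedWord {l : List (FreeGroup ℕ × ℕ)}
    (hl : ∀ b ∈ l, Tight b.1.toWord b.2) (hc : l.IsChain Nonabsorbing) :
    IsReduced (letters (markedWord 1 l)) := by
  rcases l with _ | ⟨⟨A, k⟩, l⟩
  · simp [markedWord, letters_unmark]
  · have hr := isReduced_letters_markedWord_of_chain _ _ hl hc
    rw [markedWord, letters_append, letters_unmark]
    have e : letters (((k, true), true) :: markedWord A l) =
        (k, true) :: letters (markedWord A l) := rfl
    rw [e]
    refine isReduced_append_cons FreeGroup.isReduced_toWord hr ?_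
    rw [inv_one, one_mul]
    exact hl (A, k) (by simp) _

/-- A subword of unmarked letters has at most half of all unmarked letters, because the product of
the unmarked letters is trivial. So a longer subword has a mark. -/
theorem exists_mark {l : List (FreeGroup ℕ × ℕ)}
    (hl : ∀ b ∈ l, Tight b.1.toWord b.2) (hc : l.IsChain Nonabsorbing)
    {X Y Z : List (ℕ × Bool)} (hR : (arcProd l).toWord = X ++ Y ++ Z)
    (hY : (X ++ Y ++ Z).length < 2 * Y.length + l.length) :
    ∃ Y₁ k Y₂ l₁ A l₂, Y = Y₁ ++ (k, true) :: Y₂ ∧ l = l₁ ++ (A, k) :: l₂ ∧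
      mk (X ++ Y₁) = arcProd l₁ * A ∧ l₁.length ≤ X.length + Y₁.length ∧
      l₂.length ≤ Y₂.length + Z.length := by
  have hred := isReduced_letters_markedWord hl hc
  have hmk := mk_letters_markedWord 1 l
  have hun := mk_unmarked_markedWord 1 l
  have hlen := length_unmarked_markedWord 1 l
  rw [inv_one, one_mul] at hmk
  rw [← hmk, toWord_mk_of_isReduced hred] at hR
  rw [hR] at hlen hred
  obtain ⟨M', Z', hM, hM', rfl⟩ := List.map_eq_append_iff.1 hR
  obtain ⟨X', Y', rfl, rfl, rfl⟩ := List.map_eq_append_iff.1 hM'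
  by_cases hmark : ∃ a, (a, true) ∈ Y'
  · obtain ⟨a, ha⟩ := hmark
    obtain ⟨Y₁, Y₂, rfl⟩ := List.append_of_mem ha
    obtain ⟨l₁, A, k, l₂, rfl, rfl, h1, h2, h3⟩ :=
      markedWord_eq_append_cons (P := 1) (l := l) (M₁ := X' ++ Y₁) (M₂ := Y₂ ++ Z') (a := a)
        (by rw [hM]; simp)
    refine ⟨Y₁.map Prod.fst, k, Y₂.map Prod.fst, l₁, A, l₂, by simp, rfl, ?_, ?_, ?_⟩
    · rw [← h1, one_mul, letters, List.map_append]
    · simpa using h2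
    · simpa using h3
  · exfalso
    push Not at hmark
    have hYu : unmarked Y' = Y'.map Prod.fst := by
      rw [unmarked, List.filter_eq_self.2]
      rintro ⟨a, b⟩ hab
      cases b with
      | true => exact absurd hab (hmark a)
      | false => rfl
    rw [hM, unmarked_append, unmarked_append, hYu] at hun hlen
    have hYr : IsReduced (Y'.map Prod.fst) := hred.left_of_append.right_of_append
    rw [← FreeGroup.mul_mk, ← FreeGroup.mul_mk, inv_one] at hun
    -- A reduced subword without marks is the inverse of the remaining unmarked letters up to cyclic
    -- order, so it is no longer than they are together.
    have e : mk (Y'.map Prod.fst) = (mk (unmarked X'))⁻¹ * (mk (unmarked Z'))⁻¹ := by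
      rw [eq_inv_mul_iff_mul_eq, eq_inv_iff_mul_eq_one, hun]
    have h1 := FreeGroup.norm_mul_le (mk (unmarked X'))⁻¹ (mk (unmarked Z'))⁻¹
    rw [← e, norm_mk_of_isReduced hYr, FreeGroup.norm_inv_eq, FreeGroup.norm_inv_eq] at h1
    have h2 : (mk (unmarked X')).norm ≤ (unmarked X').length := FreeGroup.norm_mk_le
    have h3 : (mk (unmarked Z')).norm ≤ (unmarked Z').length := FreeGroup.norm_mk_le
    simp only [List.length_append] at hlen hY
    omega

/-! ### Braids without small generators -/

/-- The braid is represented by a word in generators with index at least `i`. -/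
def Neutral {m : ℕ} (i : ℕ) (β : Braid m) : Prop :=
  ∃ w : List (Fin (m - 1) × Bool), (∀ a ∈ w, i ≤ (a.1 : ℕ)) ∧ wordBraid w = β

/-- The braid is represented by a word in generators with index at least `i` that does not contain
the inverse of the generator with index `i`. -/
def WeaklyPositive {m : ℕ} (i : ℕ) (β : Braid m) : Prop :=
  ∃ w : List (Fin (m - 1) × Bool),
    (∀ a ∈ w, i ≤ (a.1 : ℕ) ∧ ((a.1 : ℕ) = i → a.2 = true)) ∧ wordBraid w = β

section Words

variable {m i : ℕ} {β γ : Braid m}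

theorem neutral_one : Neutral i (1 : Braid m) := ⟨[], by simp, rfl⟩

theorem Neutral.mul (hβ : Neutral i β) (hγ : Neutral i γ) : Neutral i (β * γ) := by
  obtain ⟨v, hv, rfl⟩ := hβ
  obtain ⟨w, hw, rfl⟩ := hγ
  exact ⟨v ++ w, fun a ha => (List.mem_append.1 ha).elim (hv a) (hw a), wordBraid_append v w⟩

theorem wordBraid_invRev (w : List (Fin (m - 1) × Bool)) :
    wordBraid (invRev w) = (wordBraid w)⁻¹ := by
  rw [wordBraid, ← FreeGroup.inv_mk, map_inv]
  rfl

theorem Neutral.inv (hβ : Neutral i β) : Neutral i β⁻¹ := by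
  obtain ⟨v, hv, rfl⟩ := hβ
  refine ⟨invRev v, fun a ha => ?_, wordBraid_invRev v⟩
  simp only [invRev, List.mem_reverse, List.mem_map] at ha
  obtain ⟨b, hb, rfl⟩ := ha
  exact hv b hb

theorem neutral_sg {j : ℕ} (h : i ≤ j) : Neutral i (sg m j) := by
  by_cases hj : j < m - 1
  · exact ⟨[(⟨j, hj⟩, true)], by simpa using h, by simp [wordBraid_cons_true, wordBraid_nil]⟩
  · rw [sg_of_le (not_lt.1 hj)]
    exact neutral_one

theorem Neutral.mono {j : ℕ} (h : i ≤ j) (hβ : Neutral j β) : Neutral i β := by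
  obtain ⟨v, hv, rfl⟩ := hβ
  exact ⟨v, fun a ha => h.trans (hv a ha), rfl⟩

theorem Neutral.weaklyPositive (hβ : Neutral (i + 1) β) : WeaklyPositive i β := by
  obtain ⟨v, hv, rfl⟩ := hβ
  refine ⟨v, fun a ha => ?_, rfl⟩
  have := hv a ha
  exact ⟨by omega, fun h => by omega⟩

theorem WeaklyPositive.mul (hβ : WeaklyPositive i β) (hγ : WeaklyPositive i γ) :
    WeaklyPositive i (β * γ) := by
  obtain ⟨v, hv, rfl⟩ := hβ
  obtain ⟨w, hw, rfl⟩ := hγ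
  exact ⟨v ++ w, fun a ha => (List.mem_append.1 ha).elim (hv a) (hw a), wordBraid_append v w⟩

theorem weaklyPositive_sg : WeaklyPositive i (sg m i) := by
  by_cases hi : i < m - 1
  · exact ⟨[(⟨i, hi⟩, true)], by simp, by simp [wordBraid_cons_true, wordBraid_nil]⟩
  · rw [sg_of_le (not_lt.1 hi)]
    exact neutral_one.weaklyPositive

theorem neutral_induction {C : Braid m → Prop} (one : C 1)
    (mul : ∀ j, i ≤ j → j < m - 1 → ∀ β, C β → C (sg m j * β))
    (inv_mul : ∀ j, i ≤ j → j < m - 1 → ∀ β, C β → C ((sg m j)⁻¹ * β))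
    (hβ : Neutral i β) : C β := by
  obtain ⟨w, hw, rfl⟩ := hβ
  induction w with
  | nil => exact one
  | cons a w ih =>
    obtain ⟨j, e⟩ := a
    have hj := hw _ List.mem_cons_self
    have ih := ih fun a ha => hw a (List.mem_cons_of_mem _ ha)
    cases e with
    | true => rw [wordBraid_cons_true]; exact mul j hj j.2 _ ih
    | false => rw [wordBraid_cons_false]; exact inv_mul j hj j.2 _ ih

/-- An element fixed by the Artin automorphisms with index at least `i` is fixed by `β`. -/
theorem Neutral.artin_apply_eq {z : FreeGroup ℕ}
    (hz : ∀ j, i ≤ j → j < m - 1 → artinAut j z = z) (hβ : Neutral i β) : artin m β z = z := by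
  refine neutral_induction (C := fun β => artin m β z = z) (by simp) ?_ ?_ hβ
  · intro j hj hj' β ih
    rw [map_mul, MulAut.mul_apply, ih, artin_sg hj', hz j hj hj']
  · intro j hj hj' β ih
    rw [map_mul, MulAut.mul_apply, ih, map_inv, artin_sg hj']
    exact (MulEquiv.symm_apply_eq _).2 (hz j hj hj').symm

theorem Neutral.artin_x_of_lt {j : ℕ} (hj : j < i) (hβ : Neutral i β) :
    artin m β (x j) = x j :=
  hβ.artin_apply_eq fun k hk _ => artinAut_of_ne (by omega) (by omega)

theorem artin_x_of_le {j : ℕ} (hj : m ≤ j) (hβ : Neutral i β) : artin m β (x j) = x j :=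
  hβ.artin_apply_eq fun k _ hk => artinAut_of_ne (by omega) (by omega)

end Words

/-! ### Products of consecutive generators -/

/-- The positive word `x a ⋯ x (a + r - 1)`. -/
def segWord (a r : ℕ) : List (ℕ × Bool) := (List.range' a r).map fun j => (j, true)

/-- The product `x a ⋯ x (a + r - 1)`. -/
def seg (a r : ℕ) : FreeGroup ℕ := mk (segWord a r)

theorem segWord_succ (a r : ℕ) : segWord a (r + 1) = (a, true) :: segWord (a + 1) r := by
  simp [segWord, List.range'_succ]

theorem seg_zero (a : ℕ) : seg a 0 = 1 := rfl

theorem seg_succ (a r : ℕ) : seg a (r + 1) = x a * seg (a + 1) r := by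
  rw [seg, segWord_succ, mk_cons_true]
  rfl

theorem segWord_add (a r s : ℕ) : segWord a (r + s) = segWord a r ++ segWord (a + r) s := by
  simp [segWord, ← List.map_append, List.range'_append_1]

theorem length_segWord (a r : ℕ) : (segWord a r).length = r := by simp [segWord]

theorem isReduced_of_forall_true {L : List (ℕ × Bool)} (h : ∀ a ∈ L, a.2 = true) :
    IsReduced L := by
  induction L with
  | nil => simp
  | cons a L ih =>
    refine isReduced_cons (ih fun b hb => h b (List.mem_cons_of_mem _ hb)) fun he => ?_
    have h1 := h a List.mem_cons_self
    have h2 := h _ (List.mem_cons_of_mem _ (List.mem_of_mem_head? he))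
    simp_all

theorem forall_mem_segWord {a r : ℕ} : ∀ b ∈ segWord a r, b.2 = true := by
  simp [segWord]

theorem isReduced_segWord (a r : ℕ) : IsReduced (segWord a r) :=
  isReduced_of_forall_true forall_mem_segWord

theorem artinAut_seg_of_lt {j a r : ℕ} (h : j + 1 < a) : artinAut j (seg a r) = seg a r := by
  induction r generalizing a with
  | zero => simp [seg_zero]
  | succ r ih => rw [seg_succ, map_mul, ih (by omega), artinAut_of_ne (by omega) (by omega)]

/-- The automorphism preserves the product x_j x_{j+1} and fixes the other factors. -/
theorem artinAut_seg {j a r : ℕ} (h : a ≤ j) (hj : j + 1 < a + r) :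
    artinAut j (seg a r) = seg a r := by
  induction r generalizing a with
  | zero => simp [seg_zero]
  | succ r ih =>
    rcases eq_or_lt_of_le h with rfl | h
    · obtain ⟨r, rfl⟩ : ∃ s, r = s + 1 := ⟨r - 1, by omega⟩
      rw [seg_succ, seg_succ, map_mul, map_mul, artinAut_self, artinAut_succ,
        artinAut_seg_of_lt (by omega)]
      simp [mul_assoc]
    · rw [seg_succ, map_mul, ih (by omega) (by omega), artinAut_of_ne (by omega) (by omega)]

theorem Neutral.artin_seg {m i r : ℕ} {β : Braid m} (hβ : Neutral i β) (hr : m ≤ i + r) :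
    artin m β (seg i r) = seg i r :=
  hβ.artin_apply_eq fun _ h h' => artinAut_seg h (by omega)

/-! ### Minimising by neutral braids -/

/-- Artin's automorphisms and their inverses send generators to conjugates of generators, so
products of them do too; the conjugator can then be trimmed. -/
theorem exists_artin_eq_arc {m : ℕ} (β : Braid m) (j : ℕ) :
    ∃ (A : FreeGroup ℕ) (k : ℕ), Tight A.toWord k ∧ artin m β (x j) = arc A k := by
  have hconj : ∃ B k, artin m β (x j) = arc B k := by
    have hx : ∀ i k, ∃ B k', artinAut i (x k) = arc B k' := by
      intro i k
      by_cases h1 : k = i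
      · subst h1
        exact ⟨x k, k + 1, artinAut_self k⟩
      by_cases h2 : k = i + 1
      · subst h2
        exact ⟨1, i, by rw [artinAut_succ]; simp [arc]⟩
      · exact ⟨1, k, by rw [artinAut_of_ne h1 h2]; simp [arc]⟩
    have hx' : ∀ i k, ∃ B k', (artinAut i)⁻¹ (x k) = arc B k' := by
      intro i k
      by_cases h1 : k = i
      · subst h1
        refine ⟨1, k + 1, (MulEquiv.symm_apply_eq _).2 ?_⟩
        simp [arc, artinAut_succ]
      by_cases h2 : k = i + 1
      · subst h2
        refine ⟨(x (i + 1))⁻¹, i, (MulEquiv.symm_apply_eq _).2 ?_⟩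
        simp [arc, artinAut_succ, artinAut_self, mul_assoc]
      · refine ⟨1, k, (MulEquiv.symm_apply_eq _).2 ?_⟩
        simp [arc, artinAut_of_ne h1 h2]
    induction β using braid_induction with
    | one => exact ⟨1, j, by simp [arc]⟩
    | mul i hi β ih =>
      obtain ⟨B, k, h⟩ := ih
      obtain ⟨C, k', h'⟩ := hx i k
      refine ⟨artinAut i B * C, k', ?_⟩
      rw [map_mul, MulAut.mul_apply, h, artin_sg hi, arc, map_mul, map_mul, map_inv, h', conj_arc]
    | inv_mul i hi β ih =>
      obtain ⟨B, k, h⟩ := ih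
      obtain ⟨C, k', h'⟩ := hx' i k
      refine ⟨(artinAut i)⁻¹ B * C, k', ?_⟩
      rw [map_mul, MulAut.mul_apply, h, map_inv, artin_sg hi, arc, map_mul, map_mul, map_inv, h',
        conj_arc]
  obtain ⟨B, k, hB⟩ := hconj
  obtain ⟨A, E, hD, -, hA, he⟩ := exists_tight B.toWord k
  refine ⟨mk A, k, ?_, ?_⟩
  · rwa [toWord_mk_of_isReduced]
    have := FreeGroup.isReduced_toWord (x := B)
    rw [hD] at this
    exact List.IsChain.left_of_append this
  · rw [hB, ← he, FreeGroup.mk_toWord]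

/-- The total length of the images of the generators with index in `[a, m)`. -/
def totalNorm {m : ℕ} (a : ℕ) (β : Braid m) : ℕ := ∑ j ∈ Finset.Ico a m, (artin m β (x j)).norm

theorem sum_Ico_lt_sum_Ico {a m j : ℕ} {f g : ℕ → ℕ} (h : a ≤ j) (hj : j + 1 < m)
    (hfg : ∀ k, k ≠ j → k ≠ j + 1 → f k = g k) (hlt : f j + f (j + 1) < g j + g (j + 1)) :
    ∑ k ∈ Finset.Ico a m, f k < ∑ k ∈ Finset.Ico a m, g k := by
  have split : ∀ f : ℕ → ℕ, ∑ k ∈ Finset.Ico a m, f k =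
      ∑ k ∈ Finset.Ico a j, f k + (f j + f (j + 1)) + ∑ k ∈ Finset.Ico (j + 2) m, f k := by
    intro f
    rw [← Finset.sum_Ico_consecutive f h (by omega : j ≤ m),
      Finset.sum_eq_sum_Ico_succ_bot (by omega : j < m),
      Finset.sum_eq_sum_Ico_succ_bot hj]
    ring
  rw [split f, split g]
  have h1 : ∑ k ∈ Finset.Ico a j, f k = ∑ k ∈ Finset.Ico a j, g k :=
    Finset.sum_congr rfl fun k hk => by
      rw [Finset.mem_Ico] at hk
      exact hfg k (by omega) (by omega)
  have h2 : ∑ k ∈ Finset.Ico (j + 2) m, f k = ∑ k ∈ Finset.Ico (j + 2) m, g k :=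
    Finset.sum_congr rfl fun k hk => by
      rw [Finset.mem_Ico] at hk
      exact hfg k (by omega) (by omega)
  omega

/-- Right multiplication by σ_j is a Hurwitz move on the images: (u_j, u_{j+1}) becomes (u_j u_{j+1}
u_j⁻¹, u_j), and the others stay. -/
theorem totalNorm_mul_sg_lt {m a j : ℕ} {β : Braid m} (h : a ≤ j) (hj : j < m - 1)
    (hlt : (artin m β (x j) * artin m β (x (j + 1)) * (artin m β (x j))⁻¹).norm <
      (artin m β (x (j + 1))).norm) : totalNorm a (β * sg m j) < totalNorm a β := by
  refine sum_Ico_lt_sum_Ico h (by omega) (fun k h1 h2 => ?_) ?_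
  · rw [map_mul, MulAut.mul_apply, artin_sg hj, artinAut_of_ne h1 h2]
  · rw [map_mul, MulAut.mul_apply, MulAut.mul_apply, artin_sg hj, artinAut_self, artinAut_succ,
      map_mul, map_mul, map_inv]
    omega

theorem totalNorm_mul_sg_inv_lt {m a j : ℕ} {β : Braid m} (h : a ≤ j) (hj : j < m - 1)
    (hlt : ((artin m β (x (j + 1)))⁻¹ * artin m β (x j) * artin m β (x (j + 1))).norm <
      (artin m β (x j)).norm) : totalNorm a (β * (sg m j)⁻¹) < totalNorm a β := by
  have e1 : (artinAut j)⁻¹ (x j) = x (j + 1) :=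
    (MulEquiv.symm_apply_eq _).2 (artinAut_succ j).symm
  have e2 : (artinAut j)⁻¹ (x (j + 1)) = (x (j + 1))⁻¹ * x j * x (j + 1) :=
    (MulEquiv.symm_apply_eq _).2 (by simp [artinAut_self, artinAut_succ, mul_assoc])
  refine sum_Ico_lt_sum_Ico h (by omega) (fun k h1 h2 => ?_) ?_
  · have : (artinAut j)⁻¹ (x k) = x k :=
      (MulEquiv.symm_apply_eq _).2 (artinAut_of_ne h1 h2).symm
    rw [map_mul, MulAut.mul_apply, map_inv, artin_sg hj, this]
  · rw [map_mul, MulAut.mul_apply, MulAut.mul_apply, map_inv, artin_sg hj, e1, e2,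
      map_mul, map_mul, map_inv]
    omega

theorem exists_minimal_neutral {m : ℕ} (a : ℕ) (β : Braid m) :
    ∃ h : Braid m, Neutral a h ∧
      ∀ h' : Braid m, Neutral a h' → totalNorm a (β * h) ≤ totalNorm a (β * h * h') := by
  obtain ⟨h, hh, hmin⟩ := (InvImage.wf (fun h => totalNorm a (β * h)) Nat.lt_wfRel.wf).has_min
    {h : Braid m | Neutral a h} ⟨1, neutral_one⟩
  refine ⟨h, hh, fun g hg => ?_⟩
  rw [mul_assoc]
  exact not_lt.1 (hmin (h * g) (hh.mul hg))

/-- After multiplication by a neutral braid, long subwords of the image of `x a ⋯ x (m - 1)` have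
a mark, that is, a letter which is the conjugated generator in the image of one of the factors. -/
theorem exists_neutral_mark {m a r : ℕ} (hr : a + r = m) (β : Braid m) :
    ∃ h : Braid m, Neutral a h ∧ ∀ X Y Z : List (ℕ × Bool),
      (artin m (β * h) (seg a r)).toWord = X ++ Y ++ Z →
      (X ++ Y ++ Z).length < 2 * Y.length + r →
      ∃ Y₁ k Y₂ t, t < r ∧ Y = Y₁ ++ (k, true) :: Y₂ ∧
        artin m (β * h) (arc (seg a t) (a + t)) = arc (mk (X ++ Y₁)) k ∧
        t ≤ X.length + Y₁.length ∧ r ≤ t + 1 + Y₂.length + Z.length := by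
  obtain ⟨h, hh, hmin⟩ := exists_minimal_neutral a β
  refine ⟨h, hh, ?_⟩
  generalize β * h = γ at hmin ⊢
  choose A k htight hA using exists_artin_eq_arc γ
  have hprod : ∀ s b, arcProd ((List.range' b s).map fun j => (A j, k j)) =
      artin m γ (seg b s) := by
    intro s
    induction s with
    | zero => intro b; simp [arcProd, seg_zero]
    | succ s ih =>
      intro b
      rw [List.range'_succ, seg_succ, map_mul, ← ih, hA]
      simp [arcProd]
  -- If consecutive images violated this, one would conjugate the other to a shorter element, and a
  -- Hurwitz move by σ_b or σ_b⁻¹ would contradict minimality.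
  have hchain : ((List.range' a r).map fun j => (A j, k j)).IsChain Nonabsorbing := by
    rw [List.isChain_map]
    have hc : ∀ s b, a ≤ b → b + s ≤ m → (List.range' b s).IsChain
        fun i j => Nonabsorbing (A i, k i) (A j, k j) := by
      intro s
      induction s with
      | zero => intro b _ _; simp
      | succ s ih =>
        intro b hb hs
        rw [List.range'_succ]
        rcases s with _ | s
        · simp
        have := ih (b + 1) (by omega) (by omega)
        rw [List.range'_succ] at this ⊢
        refine List.isChain_cons_cons.2 ⟨⟨fun hd => ?_, fun hd => ?_⟩, this⟩
        · have hlt := norm_conj_lt_of_head (htight b) (htight (b + 1)) hd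
          rw [← hA, ← hA] at hlt
          exact absurd (hmin _ (neutral_sg hb))
            (not_le.2 (totalNorm_mul_sg_lt hb (by omega) hlt))
        · have hlt := norm_conj_lt_of_getLast (htight b) (htight (b + 1)) hd
          rw [← hA, ← hA] at hlt
          exact absurd (hmin _ (neutral_sg hb).inv)
            (not_le.2 (totalNorm_mul_sg_inv_lt hb (by omega) hlt))
    exact hc r a le_rfl hr.le
  intro X Y Z hR hY
  rw [← hprod] at hR
  obtain ⟨Y₁, k', Y₂, l₁, A', l₂, hY', hl, hmk, hl₁, hl₂⟩ :=
    exists_mark (fun b hb => by obtain ⟨j, -, rfl⟩ := List.mem_map.1 hb; exact htight j) hchain hR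
      (by simpa using hY)
  obtain ⟨L₁, L₂, hL, rfl, hL₂⟩ := List.map_eq_append_iff.1 hl
  obtain ⟨j, L₃, rfl, hj, rfl⟩ := List.map_eq_cons_iff.1 hL₂
  obtain ⟨t, ht, rfl, ht'⟩ := List.range'_eq_append_iff.1 hL
  have hlen := congrArg List.length ht'
  simp only [List.length_cons, List.length_range'] at hlen
  obtain ⟨s, hs⟩ : ∃ s, r - t = s + 1 := ⟨r - t - 1, by omega⟩
  rw [hs, List.range'_succ, List.cons.injEq] at ht'
  obtain ⟨rfl, -⟩ := ht'
  simp only [Nat.mul_one, Prod.mk.injEq] at hj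
  obtain ⟨rfl, rfl⟩ := hj
  refine ⟨Y₁, _, Y₂, t, by omega, hY', ?_, by simpa using hl₁, ?_⟩
  · rw [hmk, hprod, ← conj_arc, ← hA, arc, map_mul, map_mul, map_inv]
  · simp only [List.length_map] at hl₂
    omega

/-! ### Every braid is weakly positive or weakly negative -/

/-- The witness is σ_{i+t} ⋯ σ_{i+1} σ_i, with σ_i occurring once. -/
theorem exists_weaklyPositive_arc {m : ℕ} (i t : ℕ) (ht : i + t + 1 < m) :
    ∃ g : Braid m, WeaklyPositive i g ∧ Neutral i g ∧
      artin m g (x i) = arc (seg i (t + 1)) (i + t + 1) := by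
  induction t generalizing i with
  | zero =>
    refine ⟨sg m i, weaklyPositive_sg, neutral_sg le_rfl, ?_⟩
    rw [artin_sg (by omega), artinAut_self, seg_succ, seg_zero, mul_one, arc]
  | succ t ih =>
    obtain ⟨g, -, hn, hg⟩ := ih (i + 1) (by omega)
    refine ⟨g * sg m i, hn.weaklyPositive.mul weaklyPositive_sg,
      (hn.mono (by omega)).mul (neutral_sg le_rfl), ?_⟩
    rw [map_mul, MulAut.mul_apply, artin_sg (by omega), artinAut_self, map_mul, map_mul, map_inv,
      hg, hn.artin_x_of_lt (by omega), conj_arc, ← seg_succ,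
      show i + 1 + t + 1 = i + (t + 1) + 1 by omega]

/-- The witness is σ_{i+t} ⋯ σ_{i+1} σ_i⁻¹. The two families differ by conjugation of the target by
x_i, and by the sign of σ_i. -/
theorem exists_weaklyNegative_arc {m : ℕ} (i t : ℕ) (ht : i + t + 1 < m) :
    ∃ g : Braid m, WeaklyPositive i g⁻¹ ∧ Neutral i g ∧
      artin m g (x i) = arc (seg (i + 1) t) (i + 1 + t) := by
  have e1 : artin m (sg m i)⁻¹ (x i) = x (i + 1) := by
    rw [map_inv, artin_sg (by omega)]
    exact (MulEquiv.symm_apply_eq _).2 (artinAut_succ i).symm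
  rcases t with _ | t
  · refine ⟨(sg m i)⁻¹, by rw [inv_inv]; exact weaklyPositive_sg, (neutral_sg le_rfl).inv, ?_⟩
    rw [e1, seg_zero]
    simp [arc]
  · obtain ⟨g, -, hn, hg⟩ := exists_weaklyPositive_arc (m := m) (i + 1) t (by omega)
    refine ⟨g * (sg m i)⁻¹, ?_, (hn.mono (by omega)).mul (neutral_sg le_rfl).inv, ?_⟩
    · rw [mul_inv_rev, inv_inv]
      exact weaklyPositive_sg.mul hn.inv.weaklyPositive
    · rw [map_mul, MulAut.mul_apply, e1, hg]
      rfl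

/-- A braid without generators of index below `i` that fixes `x i` has no generator of index
`i`. -/
theorem neutral_succ_of_artin_eq {m i r : ℕ} (hr : i + 1 + r = m) {β : Braid m}
    (hβ : Neutral i β) (hx : artin m β (x i) = x i) : Neutral (i + 1) β := by
  obtain ⟨h, hh, hmark⟩ := exists_neutral_mark hr β
  suffices he : β * h = 1 by
    rw [eq_inv_of_mul_eq_one_left he]
    exact hh.inv
  have hγ : Neutral i (β * h) := hβ.mul (hh.mono (by omega))
  have hxi : artin m (β * h) (x i) = x i := by
    rw [map_mul, MulAut.mul_apply, hh.artin_x_of_lt (by omega), hx]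
  generalize β * h = γ at hmark hγ hxi ⊢
  have hs : artin m γ (seg (i + 1) r) = seg (i + 1) r := by
    have := hγ.artin_seg (r := r + 1) (by omega)
    rwa [seg_succ, map_mul, hxi, mul_right_inj] at this
  -- The fixed product has only r letters for r factors, so even a one-letter subword is long enough
  -- to contain a mark: every letter is one.
  have hseg : ∀ t ≤ r, artin m γ (seg (i + 1) t) = seg (i + 1) t ∧
      ∀ s < t, artin m γ (x (i + 1 + s)) = x (i + 1 + s) := by
    intro t ht
    induction t with
    | zero => simp [seg_zero]
    | succ t ih =>
      obtain ⟨ih1, ih2⟩ := ih (by omega)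
      obtain ⟨s, rfl⟩ : ∃ s, r = t + (1 + s) := ⟨r - t - 1, by omega⟩
      have hw : segWord (i + 1) (t + (1 + s)) =
          segWord (i + 1) t ++ segWord (i + 1 + t) 1 ++ segWord (i + 1 + t + 1) s := by
        rw [segWord_add, segWord_add, List.append_assoc]
      obtain ⟨Y₁, k, Y₂, t', -, hY, ha, h1, h2⟩ := hmark _ _ _
        (by rw [hs, seg, toWord_mk_of_isReduced (isReduced_segWord _ _), hw])
        (by simp only [List.length_append, length_segWord]; omega)
      have hl := congrArg List.length hY
      simp only [length_segWord, List.length_append, List.length_cons] at hl h1 h2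
      obtain rfl : Y₁ = [] := List.length_eq_zero_iff.1 (by omega)
      obtain rfl : Y₂ = [] := List.length_eq_zero_iff.1 (by omega)
      simp only [List.length_nil] at h1 h2
      -- The letter has t letters before it and r - t - 1 after it. The two bounds on the factor
      -- index therefore pin it to t.
      obtain rfl : t' = t := by omega
      have hk : k = i + 1 + t' := by
        have : segWord (i + 1 + t') 1 = [(i + 1 + t', true)] := rfl
        rw [this] at hY
        simpa [eq_comm] using hY
      subst hk
      rw [List.append_nil] at ha
      change artin m γ (arc (seg (i + 1) t') _) = arc (seg (i + 1) t') _ at ha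
      rw [arc, map_mul, map_mul, map_inv, ih1, mul_left_inj, mul_right_inj] at ha
      refine ⟨?_, fun s hs => ?_⟩
      · have : seg (i + 1) (t' + 1) = seg (i + 1) t' * x (i + 1 + t') := by
          rw [seg, segWord_add, ← FreeGroup.mul_mk]
          rfl
        rw [this, map_mul, ih1, ha]
      · rcases Nat.lt_succ_iff_lt_or_eq.1 hs with h | rfl
        · exact ih2 s h
        · exact ha
  refine artin_injective m (mulAut_ext fun j => ?_)
  rw [MulAut.one_apply]
  rcases lt_trichotomy j i with h | rfl | h
  · exact hγ.artin_x_of_lt h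
  · exact hxi
  · rcases lt_or_ge j m with h' | h'
    · have := (hseg r le_rfl).2 (j - (i + 1)) (by omega)
      rwa [show i + 1 + (j - (i + 1)) = j by omega] at this
    · exact artin_x_of_le h' hγ

theorem artin_seg_succ_eq {m i r : ℕ} (hr : i + 1 + r = m) {β : Braid m} (hβ : Neutral i β)
    {A : List (ℕ × Bool)} {k : ℕ} (hA : artin m β (x i) = arc (mk A) k) :
    artin m β (seg (i + 1) r) = mk (A ++ (k, false) :: (invRev A ++ segWord i (r + 1))) := by
  have := hβ.artin_seg (r := r + 1) (by omega)
  rw [seg_succ, map_mul, ← eq_inv_mul_iff_mul_eq] at this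
  rw [this, ← seg_succ, hA, ← FreeGroup.mul_mk, mk_cons_false, ← FreeGroup.mul_mk,
    ← FreeGroup.inv_mk, arc, seg]
  simp [mul_assoc]

/-- If the image of `x i` is a conjugate by a word that does not start with `x i`, then the braid is
weakly negative. -/
theorem weaklyPositive_inv_of_head_ne {m i r : ℕ} (hr : i + 1 + r = m) {β : Braid m}
    (hβ : Neutral i β) {D : List (ℕ × Bool)} {k : ℕ} (hD : IsReduced D)
    (hhead : D.head? ≠ some (i, true)) (he : artin m β (x i) = arc (mk D) k) :
    WeaklyPositive i β⁻¹ := by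
  induction hn : D.length using Nat.strong_induction_on generalizing β D k with
  | _ n ih =>
  obtain ⟨A, E, rfl, -, hA, hAE⟩ := exists_tight D k
  have hAr : IsReduced A := List.IsChain.left_of_append hD
  have hAhead : A.head? ≠ some (i, true) := by
    rcases A with _ | ⟨a, A⟩
    · simp
    · simpa using hhead
  rw [hAE] at he
  -- This is the only case in which A x_k⁻¹ A⁻¹ x_i ⋯ x_{m-1} is not reduced.
  by_cases htriv : A = [] ∧ k = i
  · obtain ⟨rfl, rfl⟩ := htriv
    refine (neutral_succ_of_artin_eq hr hβ ?_).inv.weaklyPositive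
    rw [he, ← FreeGroup.one_eq_mk]
    simp [arc]
  obtain ⟨h, hh, hmark⟩ := exists_neutral_mark hr β
  have hγ : Neutral i (β * h) := hβ.mul (hh.mono (by omega))
  have hxi : artin m (β * h) (x i) = arc (mk A) k := by
    rw [map_mul, MulAut.mul_apply, hh.artin_x_of_lt (by omega), he]
  suffices hw : WeaklyPositive i (β * h)⁻¹ by
    have := hh.weaklyPositive.mul hw
    rwa [mul_inv_rev, mul_inv_cancel_left] at this
  generalize β * h = γ at hmark hγ hxi ⊢
  have hred : IsReduced (A ++ (k, false) :: (invRev A ++ segWord i (r + 1))) := by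
    have h1 : IsReduced (invRev A ++ segWord i (r + 1)) := by
      rw [segWord_succ]
      refine isReduced_append_cons (isReduced_invRev hAr) ?_ ?_
      · rw [← segWord_succ]
        exact isReduced_segWord _ _
      · rw [getLast_invRev]
        intro hc
        obtain ⟨⟨p, q⟩, hp, hq⟩ := Option.map_eq_some_iff.1 hc
        refine hAhead (hp.trans ?_)
        simpa using hq
    refine isReduced_append_cons hAr (isReduced_cons h1 ?_) (hA _)
    rw [List.head?_append, head_invRev, segWord_succ]
    rcases hl : A.getLast? with _ | ⟨p, q⟩
    · rw [List.getLast?_eq_none_iff] at hl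
      have : i ≠ k := fun h => htriv ⟨hl, h.symm⟩
      simp [this]
    · have : p ≠ k := by
        rintro rfl
        exact hA _ hl
      simp [this]
  have hR : (artin m γ (seg (i + 1) r)).toWord =
      A ++ ((k, false) :: (invRev A ++ [(i, true)])) ++ segWord (i + 1) r := by
    rw [artin_seg_succ_eq hr hγ hxi, toWord_mk_of_isReduced hred, segWord_succ]
    simp
  -- The window x_k⁻¹ A⁻¹ x_i has |A| + 2 of the 2|A| + r + 2 letters, just enough for a mark. Marks
  -- are positive letters, so it is not the initial x_k⁻¹.
  obtain ⟨Y₁, l, Y₂, t, ht, hY, ha, -, -⟩ := hmark _ _ _ hR (by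
    simp only [List.length_append, List.length_cons, length_segWord, FreeGroup.invRev_length,
      List.length_nil]
    omega)
  obtain ⟨g, hg, hgn, hgx⟩ := exists_weaklyPositive_arc (m := m) i t (by omega)
  rcases Y₁ with _ | ⟨y, Y₁⟩
  · simp at hY
  rw [List.cons_append, List.cons.injEq] at hY
  obtain ⟨rfl, hY⟩ := hY
  -- The prefix up to the mark is A x_k⁻¹ Y₁; the extra conjugation by the image A x_k A⁻¹ of x_i
  -- removes x_k⁻¹.
  have hgx' : artin m (γ * g) (x i) = arc (mk A * mk Y₁) l := by
    have e : arc (seg i (t + 1)) (i + t + 1) = x i * arc (seg (i + 1) t) (i + 1 + t) * (x i)⁻¹ := by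
      rw [conj_arc, seg_succ, show i + t + 1 = i + 1 + t by omega]
    rw [map_mul, MulAut.mul_apply, hgx, e, map_mul, map_mul, map_inv, ha, hxi, conj_arc,
      ← FreeGroup.mul_mk, mk_cons_false]
    congr 1
    simp [arc, mul_assoc, -FreeGroup.mul_mk, -FreeGroup.inv_mk]
  suffices hw : WeaklyPositive i (γ * g)⁻¹ by
    have := hg.mul hw
    rwa [mul_inv_rev, mul_inv_cancel_left] at this
  -- If the mark is the final x_i, then Y₁ = A⁻¹ and the new braid fixes x_i. Otherwise it lies in
  -- A⁻¹, and A Y₁ is a proper prefix of A followed by x_l⁻¹, which is absorbed; the new conjugator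
  -- still does not begin with x_i.
  rcases List.eq_nil_or_concat Y₂ with rfl | ⟨Y₂, y, rfl⟩
  · obtain ⟨h1, h2⟩ := List.append_inj' hY rfl
    simp only [List.cons.injEq, Prod.mk.injEq, and_true] at h2
    subst h1 h2
    refine (neutral_succ_of_artin_eq hr (hγ.mul hgn) ?_).inv.weaklyPositive
    rw [hgx', ← FreeGroup.inv_mk, mul_inv_cancel]
    simp [arc]
  · rw [List.concat_eq_append, ← List.cons_append, ← List.append_assoc] at hY
    obtain ⟨h1, -⟩ := List.append_inj' hY rfl
    have hA' : A = invRev Y₂ ++ (l, false) :: invRev Y₁ := by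
      rw [← FreeGroup.invRev_invRev (L₁ := A), h1]
      simp [invRev]
    refine ih (invRev Y₂).length ?_ (hγ.mul hgn) (D := invRev Y₂) (k := l) ?_ ?_ ?_ rfl
    · rw [← hn, hA']
      simp
    · rw [hA'] at hAr
      exact List.IsChain.left_of_append hAr
    · rw [hA'] at hAhead
      rcases hq : invRev Y₂ with _ | ⟨a, L⟩
      · simp
      · rw [hq] at hAhead
        simpa using hAhead
    · have e : mk A * mk Y₁ = mk (invRev Y₂) * (x l)⁻¹ := by
        rw [hA', ← FreeGroup.mul_mk, mk_cons_false, ← FreeGroup.inv_mk (L := Y₁)]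
        simp [mul_assoc, -FreeGroup.mul_mk, -FreeGroup.inv_mk]
      rw [hgx', e]
      simp [arc, mul_assoc]

theorem exists_common_prefix (L L' : List (ℕ × Bool)) :
    ∃ C E F, L = C ++ E ∧ L' = C ++ F ∧ ∀ a, E.head? = some a → F.head? ≠ some a := by
  induction L generalizing L' with
  | nil => exact ⟨[], [], L', rfl, rfl, by simp⟩
  | cons a L ih =>
    rcases L' with _ | ⟨b, L'⟩
    · exact ⟨[], a :: L, [], rfl, rfl, by simp⟩
    · by_cases h : a = b
      · subst h
        obtain ⟨C, E, F, rfl, rfl, hd⟩ := ih L'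
        exact ⟨a :: C, E, F, rfl, rfl, hd⟩
      · refine ⟨[], a :: L, b :: L', rfl, rfl, ?_⟩
        simp [Ne.symm h]

/-- If the image of `x i` is a conjugate by a word that starts with `x i`, then the braid is weakly
positive. -/
theorem weaklyPositive_of_head_eq {m i r : ℕ} (hr : i + 1 + r = m) {β : Braid m}
    (hβ : Neutral i β) {D : List (ℕ × Bool)} {k : ℕ} (hD : IsReduced D)
    (hhead : D.head? = some (i, true) ∨ D = [] ∧ k = i) (he : artin m β (x i) = arc (mk D) k) :
    WeaklyPositive i β := by
  induction hn : D.length using Nat.strong_induction_on generalizing β D k with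
  | _ n ih =>
  obtain ⟨A, E, rfl, hE, hA, hAE⟩ := exists_tight D k
  have hAr : IsReduced A := List.IsChain.left_of_append hD
  have hAhead : A.head? = some (i, true) ∨ A = [] ∧ k = i := by
    rcases A with _ | ⟨a, A⟩
    · right
      refine ⟨rfl, ?_⟩
      rcases hhead with h | h
      · exact (hE _ (List.mem_of_mem_head? h)).symm
      · exact h.2
    · left
      simpa using hhead
  rw [hAE] at he
  rcases hAhead with hAhead | ⟨rfl, rfl⟩
  swap
  · refine (neutral_succ_of_artin_eq hr hβ ?_).weaklyPositive
    rw [he, ← FreeGroup.one_eq_mk]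
    simp [arc]
  obtain ⟨h, hh, hmark⟩ := exists_neutral_mark hr β
  have hγ : Neutral i (β * h) := hβ.mul (hh.mono (by omega))
  have hxi : artin m (β * h) (x i) = arc (mk A) k := by
    rw [map_mul, MulAut.mul_apply, hh.artin_x_of_lt (by omega), he]
  suffices hw : WeaklyPositive i (β * h) by
    have := hw.mul hh.inv.weaklyPositive
    rwa [mul_inv_cancel_right] at this
  generalize β * h = γ at hmark hγ hxi ⊢
  -- With C the common prefix of A = C E and x_i ⋯ x_{m-1} = C F, the word A x_k⁻¹ A⁻¹ x_i ⋯ x_{m-1}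
  -- becomes C E x_k⁻¹ E⁻¹ F. As C is nonempty, the part up to x_k⁻¹ is long enough to contain a
  -- mark, and a positive letter there lies in A.
  have key : ∃ Y₁ l Y₂ t, t < r ∧ A = Y₁ ++ (l, true) :: Y₂ ∧
      artin m γ (arc (seg (i + 1) t) (i + 1 + t)) = arc (mk Y₁) l := by
    obtain ⟨C, E, F, rfl, hF, hd⟩ := exists_common_prefix A (segWord i (r + 1))
    have hC : C ≠ [] := by
      rintro rfl
      rw [List.nil_append] at hF
      refine hd _ hAhead ?_
      rw [← hF, segWord_succ]
      rfl
    have hCl := List.length_pos_iff.2 hC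
    have hlen := congrArg List.length hF
    rw [length_segWord, List.length_append] at hlen
    have hFt : ∀ b ∈ C ++ F, b.2 = true := by
      rw [← hF]
      exact forall_mem_segWord
    have hmk : artin m γ (seg (i + 1) r) = mk (C ++ E ++ (k, false) :: (invRev E ++ F)) := by
      rw [artin_seg_succ_eq hr hγ hxi, hF]
      simp only [← FreeGroup.mul_mk, mk_cons_false, ← FreeGroup.inv_mk]
      simp [mul_assoc, -FreeGroup.mul_mk, -FreeGroup.inv_mk]
    -- Only here does x_k⁻¹ cancel; the image is then C F' with r letters, and the window is C = A
    -- itself.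
    by_cases hcase : E = [] ∧ F.head? = some (k, true)
    · obtain ⟨rfl, hFk⟩ := hcase
      obtain ⟨F', rfl⟩ := List.head?_eq_some_iff.1 hFk
      have hR : (artin m γ (seg (i + 1) r)).toWord = [] ++ (C ++ []) ++ F' := by
        have : mk (C ++ [] ++ (k, false) :: (invRev [] ++ (k, true) :: F')) = mk (C ++ F') := by
          simp only [List.append_nil, FreeGroup.invRev_empty, List.nil_append, ← FreeGroup.mul_mk,
            mk_cons_false, mk_cons_true]
          simp
        rw [hmk, this, toWord_mk_of_isReduced]
        · simp
        · refine isReduced_of_forall_true fun b hb => hFt b ?_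
          rcases List.mem_append.1 hb with h | h
          · exact List.mem_append_left _ h
          · exact List.mem_append_right _ (List.mem_cons_of_mem _ h)
      obtain ⟨Y₁, l, Y₂, t, ht, hY, ha, -, -⟩ := hmark _ _ _ hR (by
        simp only [List.length_append, List.length_cons, List.length_nil] at hlen ⊢
        omega)
      exact ⟨Y₁, l, Y₂, t, ht, hY, ha⟩
    · have hFr : IsReduced F := isReduced_of_forall_true fun b hb =>
        hFt b (List.mem_append_right _ hb)
      have hEr : IsReduced E := List.IsChain.right_of_append hAr
      have hEF : IsReduced (invRev E ++ F) := by
        rcases F with _ | ⟨f, F⟩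
        · simpa using isReduced_invRev hEr
        · refine isReduced_append_cons (isReduced_invRev hEr) hFr ?_
          rw [getLast_invRev]
          intro hc
          obtain ⟨⟨p, q⟩, hp, hq⟩ := Option.map_eq_some_iff.1 hc
          refine hd _ hp ?_
          obtain ⟨f1, f2⟩ := f
          simpa [eq_comm] using hq
      have hred : IsReduced (C ++ E ++ (k, false) :: (invRev E ++ F)) := by
        refine isReduced_append_cons hAr (isReduced_cons hEF ?_) (hA _)
        rw [List.head?_append, head_invRev]
        rcases hl : E.getLast? with _ | ⟨p, q⟩
        · rw [List.getLast?_eq_none_iff] at hl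
          simpa [hl] using hcase
        · have : p ≠ k := by
            rintro rfl
            refine hA q ?_
            rw [List.getLast?_append, hl]
            rfl
          simp [this]
      have hR : (artin m γ (seg (i + 1) r)).toWord =
          [] ++ (C ++ E ++ [(k, false)]) ++ (invRev E ++ F) := by
        rw [hmk, toWord_mk_of_isReduced hred]
        simp
      obtain ⟨Y₁, l, Y₂, t, ht, hY, ha, -, -⟩ := hmark _ _ _ hR (by
        simp only [List.length_append, List.length_cons, List.length_nil,
          FreeGroup.invRev_length] at hlen ⊢
        omega)
      rcases List.eq_nil_or_concat Y₂ with rfl | ⟨Y₂, y, rfl⟩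
      · obtain ⟨-, h2⟩ := List.append_inj' hY rfl
        simp at h2
      · rw [List.concat_eq_append, ← List.cons_append, ← List.append_assoc] at hY
        obtain ⟨h1, -⟩ := List.append_inj' hY rfl
        exact ⟨Y₁, l, Y₂, t, ht, h1, ha⟩
  obtain ⟨Y₁, l, Y₂, t, ht, hY, ha⟩ := key
  obtain ⟨g, hg, hgn, hgx⟩ := exists_weaklyNegative_arc (m := m) i t (by omega)
  suffices hw : WeaklyPositive i (γ * g) by
    have := hw.mul hg
    rwa [mul_inv_cancel_right] at this
  -- The new conjugator is a proper prefix of A. It is empty exactly when the mark is the initial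
  -- x_i of A, which is why the hypothesis allows an empty word with k = i.
  refine ih Y₁.length ?_ (hγ.mul hgn) (D := Y₁) (k := l) ?_ ?_ ?_ rfl
  · rw [← hn, hY]
    simp
  · rw [hY] at hAr
    exact List.IsChain.left_of_append hAr
  · rw [hY] at hAhead
    rcases Y₁ with _ | ⟨a, Y₁⟩
    · right
      simpa using hAhead
    · left
      simpa using hAhead
  · rw [map_mul, MulAut.mul_apply, hgx, ha]

theorem weaklyPositive_or_inv {m i : ℕ} (hi : i < m) {β : Braid m} (hβ : Neutral i β) :
    WeaklyPositive i β ∨ WeaklyPositive i β⁻¹ := by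
  obtain ⟨r, hr⟩ : ∃ r, i + 1 + r = m := ⟨m - (i + 1), by omega⟩
  obtain ⟨A, k, -, hA⟩ := exists_artin_eq_arc β i
  rw [← FreeGroup.mk_toWord (x := A)] at hA
  by_cases h : A.toWord.head? = some (i, true)
  · exact Or.inl (weaklyPositive_of_head_eq hr hβ FreeGroup.isReduced_toWord (Or.inl h) hA)
  · exact Or.inr (weaklyPositive_inv_of_head_ne hr hβ FreeGroup.isReduced_toWord h hA)

/-! ### The Dehornoy order -/

theorem WeaklyPositive.neutral_or_sigmaPositive {m i : ℕ} {β : Braid m}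
    (h : WeaklyPositive i β) :
    Neutral (i + 1) β ∨ ∃ w : List (Fin (m - 1) × Bool), SigmaPositive w ∧ wordBraid w = β := by
  obtain ⟨w, hw, rfl⟩ := h
  by_cases hmem : ∃ a ∈ w, (a.1 : ℕ) = i
  · obtain ⟨⟨j, e⟩, ha, rfl⟩ := hmem
    right
    obtain rfl : e = true := (hw _ ha).2 rfl
    exact ⟨w, ⟨j, ha, fun hf => absurd ((hw _ hf).2 rfl) (by simp), fun b hb => (hw b hb).1⟩, rfl⟩
  · left
    push Not at hmem
    refine ⟨w, fun a ha => ?_, rfl⟩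
    have h1 := (hw a ha).1
    have h2 := hmem a ha
    omega

/-- Every nontrivial braid or its inverse is represented by a `σ`-positive word. -/
theorem eq_one_or_sigmaPositive {m : ℕ} (β : Braid m) :
    β = 1 ∨ (∃ w : List (Fin (m - 1) × Bool), SigmaPositive w ∧ wordBraid w = β) ∨
      ∃ w : List (Fin (m - 1) × Bool), SigmaPositive w ∧ wordBraid w = β⁻¹ := by
  -- Generators are removed in order of index: either one of the two signs appears at index i, or
  -- σ_i can be avoided. At i = m only the empty word remains.
  suffices h : ∀ i, Neutral i β ∨
      (∃ w : List (Fin (m - 1) × Bool), SigmaPositive w ∧ wordBraid w = β) ∨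
      ∃ w : List (Fin (m - 1) × Bool), SigmaPositive w ∧ wordBraid w = β⁻¹ by
    refine (h m).imp_left fun hβ => ?_
    obtain ⟨w, hw, rfl⟩ := hβ
    rcases w with _ | ⟨a, w⟩
    · rfl
    · have h1 := hw a List.mem_cons_self
      have h2 := a.1.2
      omega
  intro i
  induction i with
  | zero =>
    obtain ⟨⟨w⟩, rfl⟩ := PresentedGroup.mk_surjective _ β
    exact Or.inl ⟨w, fun _ _ => Nat.zero_le _, rfl⟩
  | succ i ih =>
    rcases ih with hβ | h
    · rcases Nat.lt_or_ge i m with hi | hi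
      · rcases weaklyPositive_or_inv hi hβ with h | h
        · exact h.neutral_or_sigmaPositive.imp_right Or.inl
        · rcases h.neutral_or_sigmaPositive with h | h
          · left
            simpa using h.inv
          · exact Or.inr (Or.inr h)
      · obtain ⟨w, hw, rfl⟩ := hβ
        refine Or.inl ⟨w, fun a ha => ?_, rfl⟩
        have h1 := hw a ha
        have h2 := a.1.2
        omega
    · exact Or.inr h

theorem SigmaPositive.append {m : ℕ} {v w : List (Fin (m - 1) × Bool)} (hv : SigmaPositive v)
    (hw : SigmaPositive w) : SigmaPositive (v ++ w) := by
  obtain ⟨i, hi1, hi2, hi3⟩ := hv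
  obtain ⟨j, hj1, hj2, hj3⟩ := hw
  rcases lt_trichotomy i j with h | rfl | h
  · refine ⟨i, List.mem_append_left _ hi1, fun hm => ?_, fun a ha => ?_⟩
    · rcases List.mem_append.1 hm with hm | hm
      · exact hi2 hm
      · exact absurd (hj3 _ hm) (not_le.2 h)
    · rcases List.mem_append.1 ha with ha | ha
      · exact hi3 a ha
      · exact h.le.trans (hj3 a ha)
  · exact ⟨i, List.mem_append_left _ hi1, fun hm => (List.mem_append.1 hm).elim hi2 hj2,
      fun a ha => (List.mem_append.1 ha).elim (hi3 a) (hj3 a)⟩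
  · refine ⟨j, List.mem_append_right _ hj1, fun hm => ?_, fun a ha => ?_⟩
    · rcases List.mem_append.1 hm with hm | hm
      · exact absurd (hi3 _ hm) (not_le.2 h)
      · exact hj2 hm
    · rcases List.mem_append.1 ha with ha | ha
      · exact h.le.trans (hi3 a ha)
      · exact hj3 a ha

theorem dehornoyLT_irrefl {m : ℕ} (α : Braid m) : ¬ DehornoyLT α α := by
  rintro ⟨w, hw, he⟩
  rw [inv_mul_cancel] at he
  exact wordBraid_ne_one_of_sigmaPositive hw he

theorem DehornoyLT.trans {m : ℕ} {α β γ : Braid m} (h : DehornoyLT α β) (h' : DehornoyLT β γ) :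
    DehornoyLT α γ := by
  obtain ⟨v, hv, he⟩ := h
  obtain ⟨w, hw, he'⟩ := h'
  refine ⟨v ++ w, hv.append hw, ?_⟩
  rw [wordBraid_append, he, he']
  simp [mul_assoc]

theorem dehornoyLT_trichotomy {m : ℕ} (α β : Braid m) :
    DehornoyLT α β ∨ α = β ∨ DehornoyLT β α := by
  rcases eq_one_or_sigmaPositive (α⁻¹ * β) with h | h | h
  · exact Or.inr (Or.inl (inv_mul_eq_one.1 h))
  · exact Or.inl h
  · refine Or.inr (Or.inr ?_)
    rwa [mul_inv_rev, inv_inv] at h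

theorem exists_isDehornoyLeast {m : ℕ} {S : Set (Braid m)} (hS : S.Finite) (hne : S.Nonempty) :
    ∃ β, IsDehornoyLeast S β := by
  induction S, hS using Set.Finite.induction_on with
  | empty => exact absurd hne Set.not_nonempty_empty
  | @insert α S _ _ ih =>
    rcases S.eq_empty_or_nonempty with rfl | hS
    · exact ⟨α, by simp [IsDehornoyLeast]⟩
    obtain ⟨β, hβ, hmin⟩ := ih hS
    rcases dehornoyLT_trichotomy α β with h | h | h
    · refine ⟨α, Set.mem_insert _ _, fun γ hγ => ?_⟩
      rcases hγ with rfl | hγ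
      · exact Or.inl rfl
      · rcases hmin γ hγ with rfl | h'
        · exact Or.inr h
        · exact Or.inr (h.trans h')
    · subst h
      exact ⟨α, Set.mem_insert _ _, fun γ hγ => hγ.elim Or.inl (hmin γ)⟩
    · refine ⟨β, Set.mem_insert_of_mem _ hβ, fun γ hγ => ?_⟩
      rcases hγ with rfl | hγ
      · exact Or.inr h
      · exact hmin γ hγ

theorem IsDehornoyLeast.unique {m : ℕ} {S : Set (Braid m)} {β γ : Braid m}
    (hβ : IsDehornoyLeast S β) (hγ : IsDehornoyLeast S γ) : β = γ := by
  rcases hβ.2 γ hγ.1 with h | h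
  · exact h.symm
  rcases hγ.2 β hβ.1 with h' | h'
  · exact h'
  · exact absurd (h.trans h') (dehornoyLT_irrefl β)

/-! ### Plat classes -/

section PlatClass

variable {n : ℕ} {c : Braid (2 * n) → ℕ}

theorem PlatClass.braids_nonempty (C : PlatClass n) : C.braids.Nonempty := by
  induction C using Quotient.inductionOn with
  | _ β => exact ⟨β, rfl⟩

theorem minimalBraids_finite (hc : IsProperComplexity c) (C : PlatClass n) :
    (minimalBraids c C).Finite :=
  (hc (classComplexity c C)).subset fun _ hβ => hβ.2.le

theorem minimalBraids_nonempty (C : PlatClass n) : (minimalBraids c C).Nonempty := by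
  obtain ⟨β, hβ, he⟩ := Nat.sInf_mem (C.braids_nonempty.image c)
  exact ⟨β, hβ, he⟩

theorem isDehornoyLeast_canonicalRep (hc : IsProperComplexity c) (C : PlatClass n) :
    IsDehornoyLeast (minimalBraids c C) (canonicalRep c C) :=
  Classical.epsilon_spec
    (exists_isDehornoyLeast (minimalBraids_finite hc C) (minimalBraids_nonempty C))

theorem canonicalRep_injective (hc : IsProperComplexity c) :
    Function.Injective (canonicalRep c : PlatClass n → Braid (2 * n)) := by
  intro C₁ C₂ h
  have h₁ : DoubleCoset.mk (hilden n) (hilden n) (canonicalRep c C₁) = C₁ :=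
    (isDehornoyLeast_canonicalRep hc C₁).1.1
  have h₂ : DoubleCoset.mk (hilden n) (hilden n) (canonicalRep c C₂) = C₂ :=
    (isDehornoyLeast_canonicalRep hc C₂).1.1
  rw [← h₁, ← h₂, h]

end PlatClass

end Plat

theorem proposition3 (n : ℕ) (hn : 1 ≤ n) (c : Plat.Braid (2 * n) → ℕ)
    (hc : Plat.IsProperComplexity c) :
    (∀ C : Plat.PlatClass n,
      (Plat.minimalBraids c C).Finite ∧ (Plat.minimalBraids c C).Nonempty ∧
      (∃! β, Plat.IsDehornoyLeast (Plat.minimalBraids c C) β) ∧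
      Plat.IsDehornoyLeast (Plat.minimalBraids c C) (Plat.canonicalRep c C)) ∧
    IsStrictTotalOrder (Plat.PlatClass n) (Plat.PlatLT c) := by
  refine ⟨fun C => ?_, ?_⟩
  · have h := Plat.isDehornoyLeast_canonicalRep hc C
    exact ⟨Plat.minimalBraids_finite hc C, Plat.minimalBraids_nonempty C,
      ⟨_, h, fun _ hβ => hβ.unique h⟩, h⟩
  · exact
      { trichotomous := fun C₁ C₂ h₁ h₂ => by
          rcases Plat.dehornoyLT_trichotomy (Plat.canonicalRep c C₁) (Plat.canonicalRep c C₂) with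
            h | h | h
          · exact absurd h h₁
          -- Incomparable classes have equal representatives, hence are equal.
          · exact Plat.canonicalRep_injective hc h
          · exact absurd h h₂
        irrefl := fun _ => Plat.dehornoyLT_irrefl _
        trans := fun _ _ _ h h' => h.trans h' }
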